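/- Literals are variables $v$ and their complements $\overline v$. A clause is a finite set of literals that does not contain two complementary literals, and a clause-set $F$ is a finite set of clauses. $F$ is a 2-MU if every clause of $F$ has at most two literals, $F$ is unsatisfiable, and $F \setminus \{C\}$ is satisfiable for every $C \in F$. The deficiency $\delta(F)$ is the number of clauses of $F$ minus the number $|\mathrm{var}(F)|$ of variables occurring in $F$. Let $\mathrm{lit}(F)$ be the set of all literals whose underlying variable occurs in $F$. Two clause-sets are isomorphic, $F \cong F'$, if there is a complement-preserving bijection $f : \mathrm{lit}(F) \to \mathrm{lit}(F')$ with $\{f(C) : C \in F\} = F'$. The implication digraph $\mathrm{idg}(F)$ has vertex set $\mathrm{lit}(F)$ and arcs $\{(\overline x, x) : \{x\} \in F\} \cup \{(\overline x, y), (\overline y, x) : \{x,y\} \in F,\ x \neq y\}$; isomorphism of digraphs, also written $\cong$, is the usual one (not taking complementation of vertices into account). For $m \ge 3$, the double $m$-cycle is the digraph obtained from the undirected cycle of length $m$ by replacing every edge by two antiparallel arcs. An $m$-weak-double-cycle ($m$-WDC) is a digraph that is isomorphic to one obtained from the double $m$-cycle by a finite (possibly empty) sequence of the following operations: splitting a vertex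 $x$, i.e. replacing $x$ by two new vertices $u, v$ and an arc $(u,v)$ so that all arcs coming into $x$ come into $u$ and all arcs going out of $x$ go out of $v$; and splitting an arc $(x,y)$, i.e. replacing it by two arcs $(x,v), (v,y)$ with a new vertex $v$. **Corollary.** Let $k \ge 2$ and let $F, F'$ be 2-MUs with $\delta(F) = \delta(F') = k$. Then $F \cong F'$ if and only if $\mathrm{idg}(F) \cong \mathrm{idg}(F')$. Moreover, $\mathrm{idg}(F)$ and $\mathrm{idg}(F')$ are $2k$-WDCs. -/

import Mathlib

universe u

namespace TwoMU

section ClauseSets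

/-- Literals over the variables `V`: `(v, true)` is the variable `v` itself and `(v, false)` is
its complement. -/
abbrev Lit (V : Type u) : Type u := V × Bool

/-- The complement of a literal. -/
def compl {V : Type u} (x : Lit V) : Lit V := (x.1, !x.2)

/-- Finite sets of finite sets of literals; clause-sets are those that also satisfy
`IsClauseSet`. -/
abbrev ClauseSet (V : Type u) : Type u := Finset (Finset (Lit V))

/-- Every clause is clash-free, that is, contains no two complementary literals. -/
def IsClauseSet {V : Type u} (F : ClauseSet V) : Prop :=
  ∀ C ∈ F, ∀ x ∈ C, compl x ∉ C

/-- Satisfiability: some truth assignment makes at least one literal of every clause true. -/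
def Satisfiable {V : Type u} (F : ClauseSet V) : Prop :=
  ∃ τ : V → Bool, ∀ C ∈ F, ∃ x ∈ C, τ x.1 = x.2

/-- `F` is unsatisfiable, but the removal of any clause makes it satisfiable. -/
def MinimallyUnsat {V : Type u} [DecidableEq V] (F : ClauseSet V) : Prop :=
  ¬ Satisfiable F ∧ ∀ C ∈ F, Satisfiable (F.erase C)

/-- 2-MUs: minimally unsatisfiable clause-sets all of whose clauses have at most two literals. -/
def IsTwoMU {V : Type u} [DecidableEq V] (F : ClauseSet V) : Prop :=
  IsClauseSet F ∧ MinimallyUnsat F ∧ ∀ C ∈ F, C.card ≤ 2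

/-- The variables occurring in `F` (positively or negatively). -/
def vars {V : Type u} [DecidableEq V] (F : ClauseSet V) : Finset V :=
  F.biUnion fun C => C.image Prod.fst

/-- All literals whose underlying variable occurs in `F`. -/
def lits {V : Type u} [DecidableEq V] (F : ClauseSet V) : Finset (Lit V) :=
  vars F ×ˢ Finset.univ

/-- The deficiency: number of clauses minus number of variables. -/
def deficiency {V : Type u} [DecidableEq V] (F : ClauseSet V) : ℤ :=
  (F.card : ℤ) - ((vars F).card : ℤ)

/-- Isomorphism of clause-sets: a complement-preserving bijection from the literals of `F` to the
literals of `F'` that maps the set of clauses of `F` to the set of clauses of `F'`. (The values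
of `f` outside of `lits F` are irrelevant.) -/
def ClauseSetIso {V : Type u} [DecidableEq V] (F F' : ClauseSet V) : Prop :=
  ∃ f : Lit V → Lit V,
    Set.BijOn f (lits F : Set (Lit V)) (lits F' : Set (Lit V)) ∧
    (∀ x ∈ lits F, f (compl x) = compl (f x)) ∧
    F.image (fun C => C.image f) = F'

/-- The implication digraph. Its vertices are the literals of `F`; there is an arc `a → b` iff
the clause consisting of `compl a` and `b` belongs to `F`. So a binary clause on `x ≠ y` gives the
arcs `compl x → y` and `compl y → x`, and a unit clause on `x` gives the arc `compl x → x` (the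
case `compl a = b`). -/
def idg {V : Type u} [DecidableEq V] (F : ClauseSet V) : Digraph {x : Lit V // x ∈ lits F} where
  Adj a b := ({compl a.1, b.1} : Finset (Lit V)) ∈ F

end ClauseSets

section WeakDoubleCycles

/-- Isomorphism of digraphs: a bijection between the vertices under which arcs correspond to
arcs. -/
def DigraphIso {α β : Type*} (G : Digraph α) (H : Digraph β) : Prop :=
  ∃ f : α ≃ β, ∀ a b, G.Adj a b ↔ H.Adj (f a) (f b)

/-- The double `m`-cycle: every edge of the undirected cycle on `m` vertices is replaced by two
antiparallel arcs. -/
def doubleCycle (m : ℕ) : Digraph (Fin m) where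
  Adj a b := (SimpleGraph.cycleGraph m).Adj a b

/-- Splitting the vertex `x`: `x` is replaced by two vertices `u = some x` and `v = none` and an
arc `u → v`, such that all arcs coming into `x` come into `u`, and all arcs going out of `x` go
out of `v`. -/
def splitVertex {α : Type u} (G : Digraph α) (x : α) : Digraph (Option α) where
  Adj
    | some a, some b => a ≠ x ∧ G.Adj a b
    | some a, none => a = x
    | none, some b => G.Adj x b
    | none, none => False

/-- Splitting the arc `x → y`: it is replaced by `x → v → y` for a new vertex `v = none`. -/
def splitArc {α : Type u} (G : Digraph α) (x y : α) : Digraph (Option α) where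
  Adj
    | some a, some b => ¬ (a = x ∧ b = y) ∧ G.Adj a b
    | some a, none => a = x
    | none, some b => b = y
    | none, none => False

/-- `m`-weak-double-cycles: the digraphs obtained, up to isomorphism, from the double `m`-cycle,
`m ≥ 3`, by any finite number (possibly zero) of splittings of vertices or arcs, in any order. -/
inductive IsWDC (m : ℕ) : {α : Type u} → Digraph α → Prop
  | doubleCycle {α : Type u} (G : Digraph α) (hm : 3 ≤ m)
      (h : DigraphIso (TwoMU.doubleCycle m) G) : IsWDC m G
  | splitVertex {α β : Type u} (G : Digraph α) (x : α) (H : Digraph β) (hG : IsWDC m G)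
      (h : DigraphIso (TwoMU.splitVertex G x) H) : IsWDC m H
  | splitArc {α β : Type u} (G : Digraph α) (x y : α) (hxy : G.Adj x y) (H : Digraph β)
      (hG : IsWDC m G) (h : DigraphIso (TwoMU.splitArc G x y) H) : IsWDC m H

end WeakDoubleCycles

end TwoMU

/-! Write σ for the complementation of literals. Deleting a binary clause deletes an arc together
with its contrapositive, and by the 2-SAT theorem unsatisfiability means that some x and σ x lie on
a common closed walk. So the implication digraph of a 2-MU without the empty clause is strongly
connected, and the arcs of any such closed walk, together with their contrapositives, are all the
arcs (`IsSkewMinimal`). Simple walks from x to σ x and back then show that all in- and out-degrees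
are one or two. For k ≥ 2 there are no unit clauses, and counting arcs gives exactly 2k vertices of
in-degree two (`IsTwoMU.card_twoIn`).

If every in-degree is two, counting forces each walk from x to σ x through different variables to
have length k, and the digraph is the double 2k-cycle with σ antipodal (`exists_double_cycle`).
Otherwise some x has a single predecessor b. Contracting b → x and σ x → σ b keeps skew-minimality
and the number 2k, and is undone by two arc splittings or two vertex splittings (`exists_collapse`).
Induction gives the weak double cycle, together with labels in ℤ/2k such that σ adds k on the
vertices of in-degree two (`isWDC_and_exists_labeling`).

Two such labellings differ by a dihedral symmetry, which commutes with adding k. Hence the digraph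
determines σ (`IsSkewMinimal.compl_unique`), so every digraph isomorphism respects complements and
comes from an isomorphism of clause-sets. -/

open Relation

namespace TwoMU

/-! ### Walks and simple paths -/

section Paths

variable {α : Type u}

/-- `p 0, …, p n` is a walk along the arcs of `A`. -/
def IsPath (A : α → α → Prop) (p : ℕ → α) (n : ℕ) : Prop :=
  ∀ i < n, A (p i) (p (i + 1))

/-- The arc `a → b` or its contrapositive occurs on the walk `p 0, …, p n`. -/
def OnPath (σ : α → α) (p : ℕ → α) (n : ℕ) (a b : α) : Prop :=
  ∃ i < n, (a = p i ∧ b = p (i + 1)) ∨ (a = σ (p (i + 1)) ∧ b = σ (p i))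

theorem IsPath.reflTransGen {A : α → α → Prop} {p : ℕ → α} {n : ℕ} (h : IsPath A p n) {i j : ℕ}
    (hij : i ≤ j) (hj : j ≤ n) : ReflTransGen A (p i) (p j) := by
  induction j, hij using Nat.le_induction with
  | base => exact .refl
  | succ j hij ih => exact (ih (by omega)).tail (h j (by omega))

theorem exists_simple_path {A : α → α → Prop} {x y : α} (h : ReflTransGen A x y) :
    ∃ n p, p 0 = x ∧ p n = y ∧ IsPath A p n ∧ ∀ i j, i ≤ n → j ≤ n → p i = p j → i = j := by
  classical
  have hex : ∃ n p, p 0 = x ∧ p n = y ∧ IsPath A p n := by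
    induction h with
    | refl => exact ⟨0, fun _ => x, rfl, rfl, fun i hi => by omega⟩
    | @tail b c _ hbc ih =>
      obtain ⟨n, p, h0, hn, hp⟩ := ih
      refine ⟨n + 1, fun t => if t ≤ n then p t else c, by simpa, by simp, fun i hi => ?_⟩
      rcases Nat.lt_or_ge i n with h | h
      · simpa [h.le, Nat.succ_le_of_lt h] using hp i h
      · obtain rfl : i = n := by omega
        simpa [hn] using hbc
  obtain ⟨p, h0, hn, hp⟩ := Nat.find_spec hex
  have hmin := fun m => Nat.find_min' hex (m := m)
  set n := Nat.find hex
  have key : ∀ i j, i < j → j ≤ n → p i ≠ p j := by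
    intro i j hij hj e
    -- Cutting out the loop between the positions `i` and `j` would give a shorter walk.
    have := hmin (n - (j - i)) ⟨fun t => if t ≤ i then p t else p (t + (j - i)), by simpa, ?_, ?_⟩
    · omega
    · by_cases h : n - (j - i) ≤ i
      · have h1 : n - (j - i) = i := by omega
        have h2 : j = n := by omega
        simp only [h1, le_refl, if_true]
        rw [e, h2, hn]
      · simp only [h, if_false]
        rw [show n - (j - i) + (j - i) = n by omega, hn]
    · intro t ht
      rcases lt_trichotomy t i with h | h | h
      · simpa [h.le, Nat.succ_le_of_lt h] using hp t (by omega)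
      · subst h
        simp only [le_refl, if_true, show ¬ t + 1 ≤ t by omega, if_false]
        rw [e, show t + 1 + (j - t) = j + 1 by omega]
        exact hp j (by omega)
      · simp only [show ¬ t ≤ i by omega, show ¬ t + 1 ≤ i by omega, if_false]
        rw [show t + 1 + (j - i) = t + (j - i) + 1 by omega]
        exact hp _ (by omega)
  refine ⟨n, p, h0, hn, hp, fun i j hi hj e => ?_⟩
  rcases lt_trichotomy i j with h | h | h
  · exact absurd e (key i j h hj)
  · exact h
  · exact absurd e.symm (key j i h hi)

theorem reflTransGen_skew {σ : α → α} {B : α → α → Prop}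
    (hB : ∀ x y, B x y → B (σ y) (σ x)) {x y : α} (h : ReflTransGen B x y) :
    ReflTransGen B (σ y) (σ x) := by
  induction h with
  | refl => exact .refl
  | tail _ hbc ih => exact ReflTransGen.head (hB _ _ hbc) ih

end Paths

/-! ### Skew-minimal digraphs: degrees and lassos -/

/-- A strongly connected digraph with a fixed-point-free skew-symmetry `σ` in which no proper
skew-closed set of arcs supports a closed walk through some `x` and `σ x`. -/
structure IsSkewMinimal {α : Type u} (A : α → α → Prop) (σ : α → α) : Prop where
  invol : ∀ x, σ (σ x) = x
  ne : ∀ x, σ x ≠ x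
  skew : ∀ {x y}, A x y → A (σ y) (σ x)
  conn : ∀ x y, ReflTransGen A x y
  minimal : ∀ B : α → α → Prop, (∀ x y, B x y → A x y) → (∀ x y, B x y → B (σ y) (σ x)) →
    ∀ x, ReflTransGen B x (σ x) → ReflTransGen B (σ x) x → ∀ a b, A a b → B a b

/-- The vertex `z` has at least two predecessors. -/
def TwoIn {α : Type u} (A : α → α → Prop) (z : α) : Prop :=
  ∃ y y', y ≠ y' ∧ A y z ∧ A y' z

/-- The vertices `q 0, …, q (s - 1)` belong to different variables. -/
def VarSimple {α : Type u} (σ : α → α) (q : ℕ → α) (s : ℕ) : Prop :=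
  ∀ i j, i < s → j < s → q i = q j ∨ q i = σ (q j) → i = j

namespace IsSkewMinimal

variable {α : Type u} {A : α → α → Prop} {σ : α → α}

theorem inj (H : IsSkewMinimal A σ) {x y : α} (h : σ x = σ y) : x = y := by
  rw [← H.invol x, h, H.invol]

theorem eq_iff (H : IsSkewMinimal A σ) {x y : α} : σ x = y ↔ x = σ y :=
  ⟨fun h => by rw [← h, H.invol], fun h => by rw [h, H.invol]⟩

theorem skew_iff (H : IsSkewMinimal A σ) {x y : α} : A (σ y) (σ x) ↔ A x y :=
  ⟨fun h => by simpa [H.invol] using H.skew h, H.skew⟩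

theorem onPath_skew (H : IsSkewMinimal A σ) {p : ℕ → α} {n : ℕ} {a b : α}
    (h : OnPath σ p n a b) : OnPath σ p n (σ b) (σ a) := by
  obtain ⟨i, hi, ⟨rfl, rfl⟩ | ⟨rfl, rfl⟩⟩ := h
  · exact ⟨i, hi, .inr ⟨rfl, rfl⟩⟩
  · exact ⟨i, hi, .inl ⟨H.invol _, H.invol _⟩⟩

theorem of_onPath (H : IsSkewMinimal A σ) {p : ℕ → α} {n : ℕ} (hp : IsPath A p n) {a b : α}
    (h : OnPath σ p n a b) : A a b := by
  obtain ⟨i, hi, ⟨rfl, rfl⟩ | ⟨rfl, rfl⟩⟩ := h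
  · exact hp i hi
  · exact H.skew (hp i hi)

/-- Loops can be dropped from any walk, so the arcs that are not loops still connect everything and
must be all arcs. -/
theorem irrefl (H : IsSkewMinimal A σ) (x : α) : ¬ A x x := by
  intro h
  have hr : ∀ a b, ReflTransGen A a b → ReflTransGen (fun u v => A u v ∧ u ≠ v) a b := by
    intro a b hab
    induction hab with
    | refl => exact .refl
    | @tail b c _ hbc ih =>
      by_cases e : b = c
      · exact e ▸ ih
      · exact ih.tail ⟨hbc, e⟩
  exact (H.minimal (fun u v => A u v ∧ u ≠ v) (fun _ _ h => h.1)
    (fun _ _ h => ⟨H.skew h.1, fun e => h.2 (H.inj e).symm⟩) x (hr _ _ (H.conn _ _))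
    (hr _ _ (H.conn _ _)) x x h).2 rfl

/-- An arc that can be bypassed without using its contrapositive does not exist. -/
theorem not_adj_of_bypass (H : IsSkewMinimal A σ) {a z b : α} (haz : A a z) (hzb : A z b)
    (h1 : a ≠ σ z) (h2 : b ≠ σ z) : ¬ A a b := by
  intro hab
  have hza : a ≠ z := fun e => H.irrefl _ (e ▸ haz)
  have hbz : z ≠ b := fun e => H.irrefl _ (e ▸ hzb)
  -- All arcs but `a → b` and its contrapositive. By `h1` and `h2` the detour through `z` stays in
  -- `B`, and its skew image bypasses the contrapositive.
  set B : α → α → Prop := fun u v => A u v ∧ ¬ (u = a ∧ v = b) ∧ ¬ (u = σ b ∧ v = σ a)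
  have s1 : B a z := ⟨haz, fun h => hbz h.2, fun h => h1 (by rw [h.2, H.invol])⟩
  have s2 : B z b := ⟨hzb, fun h => hza h.1.symm, fun h => h2 (by rw [h.1, H.invol])⟩
  have hBs : ∀ x y, B x y → B (σ y) (σ x) := fun x y h =>
    ⟨H.skew h.1, fun e => h.2.2 ⟨by rw [← e.2, H.invol], by rw [← e.1, H.invol]⟩,
      fun e => h.2.1 ⟨H.inj e.2, H.inj e.1⟩⟩
  have hr : ∀ x y, ReflTransGen B x y := by
    intro x y
    refine ReflTransGen.lift' (p := B) id ?_ _ _ (H.conn x y)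
    intro u v huv
    by_cases e1 : u = a ∧ v = b
    · rw [e1.1, e1.2]; exact (ReflTransGen.single s1).tail s2
    · by_cases e2 : u = σ b ∧ v = σ a
      · rw [e2.1, e2.2]; exact (ReflTransGen.single (hBs _ _ s2)).tail (hBs _ _ s1)
      · exact .single ⟨huv, e1, e2⟩
  exact (H.minimal B (fun _ _ h => h.1) hBs a (hr _ _) (hr _ _) a b hab).2.1 ⟨rfl, rfl⟩

/-- All arcs occur, up to contraposition, on any two walks from `x` to `σ x` and back. -/
theorem cover (H : IsSkewMinimal A σ) {p q : ℕ → α} {r s : ℕ} (hp : IsPath A p r)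
    (hq : IsPath A q s) (hpr : p r = σ (p 0)) (hq0 : q 0 = σ (p 0)) (hqs : q s = p 0) {a b : α}
    (hab : A a b) : OnPath σ p r a b ∨ OnPath σ q s a b := by
  refine H.minimal (fun a b => OnPath σ p r a b ∨ OnPath σ q s a b) ?_ ?_ (p 0) ?_ ?_ a b hab
  · rintro x y (h | h)
    exacts [H.of_onPath hp h, H.of_onPath hq h]
  · rintro x y (h | h)
    exacts [.inl (H.onPath_skew h), .inr (H.onPath_skew h)]
  · rw [← hpr]
    exact IsPath.reflTransGen (fun i hi => .inl ⟨i, hi, .inl ⟨rfl, rfl⟩⟩) (Nat.zero_le r) le_rfl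
  · rw [← hq0, ← hqs]
    exact IsPath.reflTransGen (fun i hi => .inr ⟨i, hi, .inl ⟨rfl, rfl⟩⟩) (Nat.zero_le s) le_rfl

/-- The cover by simple paths from `x` to `σ x` and back. -/
theorem simple_cover (H : IsSkewMinimal A σ) (x : α) : ∃ p q : ℕ → α, ∃ r s : ℕ,
    IsPath A p r ∧ IsPath A q s ∧ p 0 = x ∧ p r = σ x ∧ q 0 = σ x ∧ q s = x ∧
    (∀ i j, i ≤ r → j ≤ r → p i = p j → i = j) ∧ (∀ i j, i ≤ s → j ≤ s → q i = q j → i = j) ∧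
    ∀ a b, A a b → OnPath σ p r a b ∨ OnPath σ q s a b := by
  obtain ⟨r, p, hp0, hpr, hp, hpi⟩ := exists_simple_path (H.conn x (σ x))
  obtain ⟨s, q, hq0, hqs, hq, hqi⟩ := exists_simple_path (H.conn (σ x) x)
  refine ⟨p, q, r, s, hp, hq, hp0, hpr, hq0, hqs, hpi, hqi, fun a b => ?_⟩
  subst hp0
  exact H.cover hp hq hpr hq0 hqs

theorem exists_out (H : IsSkewMinimal A σ) (x : α) : ∃ y, A x y := by
  rcases (H.conn x (σ x)).cases_head with h | ⟨y, h, _⟩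
  · exact absurd h.symm (H.ne x)
  · exact ⟨y, h⟩

theorem exists_in (H : IsSkewMinimal A σ) (x : α) : ∃ y, A y x := by
  obtain ⟨y, h⟩ := H.exists_out (σ x)
  exact ⟨σ y, by simpa [H.invol] using H.skew h⟩

/-- On simple walks `p` from `x` to `σ x` and `q` back, an arc leaving `x` can only be the first arc
of `p` or the contrapositive of its last one; `q` neither leaves `x` nor enters `σ x`. -/
theorem out_le_two (H : IsSkewMinimal A σ) (x : α) :
    ∃ a b, ∀ v, A x v → v = a ∨ v = b := by
  obtain ⟨p, q, r, s, hp, hq, hp0, hpr, hq0, hqs, hpi, hqi, hc⟩ := H.simple_cover x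
  refine ⟨p 1, σ (p (r - 1)), fun v hv => ?_⟩
  rcases hc x v hv with ⟨i, hi, ⟨e, rfl⟩ | ⟨e, rfl⟩⟩ | ⟨i, hi, ⟨e, rfl⟩ | ⟨e, rfl⟩⟩
  · have := hpi 0 i (by omega) (by omega) (by rw [hp0, e])
    subst this; exact .inl rfl
  · have := hpi (i + 1) r (by omega) (by omega) (by rw [hpr, e, H.invol])
    subst this; exact .inr rfl
  · have := hqi i s (by omega) (by omega) (by rw [hqs, e])
    omega
  · have := hqi (i + 1) 0 (by omega) (by omega) (by rw [hq0, e, H.invol])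
    omega

theorem in_le_two (H : IsSkewMinimal A σ) {x a b c : α} (ha : A a x) (hb : A b x) (hc : A c x) :
    a = b ∨ a = c ∨ b = c := by
  obtain ⟨u, v, h⟩ := H.out_le_two (σ x)
  have h1 := h _ (H.skew ha)
  have h2 := h _ (H.skew hb)
  have h3 := h _ (H.skew hc)
  have i1 := @inj _ _ _ H a b
  have i2 := @inj _ _ _ H a c
  have i3 := @inj _ _ _ H b c
  grind

/-- No arc leads back to the unique predecessor. -/
theorem not_adj_back (H : IsSkewMinimal A σ) {x b : α} (hx : ¬ TwoIn A x) (hbx : A b x)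
    (hne : b ≠ σ x) : ¬ A x b := by
  intro hxb
  have huniq : ∀ z, A z x → z = b := fun z hz => by
    by_contra hzb; exact hx ⟨z, b, hzb, hz, hbx⟩
  have hout : ∀ z, A (σ x) z → z = σ b := fun z hz => by
    have := huniq (σ z) (by simpa [H.invol] using H.skew hz)
    rw [← this, H.invol]
  -- With base point `b`, the walk `p` can neither re-enter `b` nor leave `σ b`. On `q`, using `x →
  -- b` or its contrapositive would visit `b` or `σ b` twice, because `x` is entered only from `b`
  -- and `σ x` left only to `σ b`.
  obtain ⟨p, q, r, s, hp, hq, hp0, hpr, hq0, hqs, hpi, hqi, hc⟩ := H.simple_cover b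
  rcases hc x b hxb with ⟨i, hi, ⟨e, e'⟩ | ⟨e, e'⟩⟩ | ⟨i, hi, ⟨e, e'⟩ | ⟨e, e'⟩⟩
  · have := hpi 0 (i + 1) (by omega) (by omega) (by rw [hp0, e'])
    omega
  · have := hpi i r (by omega) (by omega) (by rw [hpr, e', H.invol])
    omega
  · rcases i with _ | i
    · apply hne; rw [e, hq0, H.invol]
    · have h1 := huniq (q i) (by rw [e]; exact hq i (by omega))
      have := hqi i s (by omega) (by omega) (by rw [h1, hqs])
      omega
  · have e2 : q (i + 1) = σ x := by rw [e, H.invol]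
    rcases Nat.lt_or_ge (i + 1) s with h | h
    · have h1 := hout (q (i + 1 + 1)) (by rw [← e2]; exact hq (i + 1) (by omega))
      have := hqi (i + 1 + 1) 0 (by omega) (by omega) (by rw [h1, hq0])
      omega
    · obtain rfl : s = i + 1 := by omega
      exact hne (by rw [← hqs, e2])

/-- From `σ x` there is a walk through different variables that ends with the complement of one
of its vertices and which, together with a given walk from `x` to `σ x`, contains all arcs. -/
theorem lasso (H : IsSkewMinimal A σ) {p : ℕ → α} {r : ℕ} (hp : IsPath A p r)
    (hpr : p r = σ (p 0)) : ∃ (s j : ℕ) (q : ℕ → α), j < s ∧ q 0 = σ (p 0) ∧ IsPath A q s ∧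
      VarSimple σ q s ∧ q s = σ (q j) ∧ ∀ a b, A a b → OnPath σ p r a b ∨ OnPath σ q s a b := by
  classical
  obtain ⟨n, q, hq0, hqn, hq, hqi⟩ := exists_simple_path (H.conn (σ (p 0)) (p 0))
  -- The lasso stops at the first vertex whose complement was already visited.
  have hex : ∃ t, t ≤ n ∧ ∃ j < t, q t = σ (q j) := by
    refine ⟨n, le_rfl, 0, ?_, by rw [hqn, hq0, H.invol]⟩
    rcases Nat.eq_zero_or_pos n with h | h
    · subst h; exact absurd (hq0.symm.trans hqn) (H.ne _)
    · exact h
  obtain ⟨hsn, j, hjs, hs⟩ := Nat.find_spec hex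
  have hmin := fun m => Nat.find_min hex (m := m)
  set s := Nat.find hex
  have hqs : IsPath A q s := fun i hi => hq i (by omega)
  refine ⟨s, j, q, hjs, hq0, hqs, ?_, hs, fun a b hab => ?_⟩
  · rintro i j hi hj (h | h)
    · exact hqi i j (by omega) (by omega) h
    · rcases lt_trichotomy i j with h' | h' | h'
      · exact absurd ⟨by omega, i, h', by rw [h, H.invol]⟩ (hmin j hj)
      · exact h'
      · exact absurd ⟨by omega, j, h', h⟩ (hmin i hi)
  set B : α → α → Prop := fun a b => OnPath σ p r a b ∨ OnPath σ q s a b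
  have hBs : ∀ x y, B x y → B (σ y) (σ x) := by
    rintro x y (h | h)
    exacts [.inl (H.onPath_skew h), .inr (H.onPath_skew h)]
  have hBq : IsPath B q s := fun i hi => .inr ⟨i, hi, .inl ⟨rfl, rfl⟩⟩
  have hBp : IsPath B p r := fun i hi => .inl ⟨i, hi, .inl ⟨rfl, rfl⟩⟩
  refine H.minimal B ?_ hBs (p 0) ?_ ?_ a b hab
  · rintro x y (h | h)
    exacts [H.of_onPath hp h, H.of_onPath hqs h]
  · rw [← hpr]
    exact hBp.reflTransGen (Nat.zero_le _) le_rfl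
  · rw [← hq0]
    -- From `q s = σ (q j)`, the contrapositive of the initial segment up to `q j` leads back to `p
    -- 0`.
    refine (hBq.reflTransGen (Nat.zero_le s) le_rfl).trans ?_
    rw [hs]
    have := reflTransGen_skew hBs (hBq.reflTransGen (Nat.zero_le j) hjs.le)
    rwa [hq0, H.invol] at this

end IsSkewMinimal

end TwoMU

/-! ### Counting variables and arcs -/

namespace TwoMU

/-- No arc leads from a vertex to its complement. -/
def NoUnit {α : Type u} (A : α → α → Prop) (σ : α → α) : Prop := ∀ x, ¬ A x (σ x)

/-- The vertices `q t` and their complements are `2 * s` distinct vertices; in the case of equality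
they exhaust `α`. -/
theorem VarSimple.two_mul_le {α : Type u} [Finite α] {σ : α → α} {q : ℕ → α} {s : ℕ}
    (hq : VarSimple σ q s) (hne : ∀ x, σ x ≠ x) (hinj : Function.Injective σ) :
    2 * s ≤ Nat.card α ∧
      (2 * s = Nat.card α → ∀ z, ∃ t < s, z = q t ∨ z = σ (q t)) := by
  let f : Fin s × Bool → α := fun i => if i.2 then q i.1 else σ (q i.1)
  have hf : Function.Injective f := by
    rintro ⟨⟨i, hi⟩, a⟩ ⟨⟨j, hj⟩, b⟩ h
    cases a <;> cases b <;> simp only [f, Bool.false_eq_true, if_true, if_false] at h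
    · obtain rfl := hq i j hi hj (.inl (hinj h)); rfl
    · obtain rfl := hq j i hj hi (.inr h.symm)
      exact absurd h (hne _)
    · obtain rfl := hq i j hi hj (.inr h)
      exact absurd h.symm (hne _)
    · obtain rfl := hq i j hi hj (.inl h); rfl
  have hc : Nat.card (Fin s × Bool) = 2 * s := by simp [mul_comm]
  refine ⟨hc ▸ Nat.card_le_card_of_injective f hf, fun h z => ?_⟩
  have hb : Function.Bijective f :=
    (Nat.bijective_iff_injective_and_card f).2 ⟨hf, by rw [hc, h]⟩
  obtain ⟨⟨⟨i, hi⟩, b⟩, rfl⟩ := hb.2 z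
  refine ⟨i, hi, ?_⟩
  cases b <;> simp [f]

theorem VarSimple.mono {α : Type u} {σ : α → α} {q q' : ℕ → α} {s s' m : ℕ}
    (hq : VarSimple σ q s) (hs : s' + m ≤ s) (h : ∀ t < s', q' t = q (m + t)) :
    VarSimple σ q' s' := fun i j hi hj e => by
  have := hq (m + i) (m + j) (by omega) (by omega) (by rwa [← h i hi, ← h j hj])
  omega

namespace IsSkewMinimal

variable {α : Type u} {A : α → α → Prop} {σ : α → α}

theorem twoIn_skew_iff (H : IsSkewMinimal A σ) {z : α} :
    TwoIn A (σ z) ↔ ∃ y y', y ≠ y' ∧ A z y ∧ A z y' := by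
  constructor
  · rintro ⟨y, y', hne, h, h'⟩
    exact ⟨σ y, σ y', fun e => hne (H.inj e), by simpa [H.invol] using H.skew h,
      by simpa [H.invol] using H.skew h'⟩
  · rintro ⟨y, y', hne, h, h'⟩
    exact ⟨σ y, σ y', fun e => hne (H.inj e), H.skew h, H.skew h'⟩

/-- Every in-degree is one or two: positive by strong connectivity, at most two by `in_le_two`. This
is what ties the deficiency to the vertices of in-degree two. -/
theorem card_arcs [Finite α] (H : IsSkewMinimal A σ) :
    Nat.card {e : α × α // A e.1 e.2} = Nat.card α + Nat.card {z // TwoIn A z} := by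
  classical
  have := Fintype.ofFinite α
  have h1 : Nat.card {e : α × α // A e.1 e.2} =
      ∑ z, (Finset.univ.filter fun y => A y z).card := by
    rw [Nat.card_eq_fintype_card, Fintype.card_subtype,
      Finset.card_eq_sum_card_fiberwise (f := Prod.snd) (t := Finset.univ) (by simp)]
    refine Finset.sum_congr rfl fun z _ => ?_
    refine Finset.card_bij (fun e _ => e.1) ?_ ?_ ?_
    · rintro ⟨a, b⟩ h; simp at h ⊢; rw [← h.2]; exact h.1
    · rintro ⟨a, b⟩ h ⟨a', b'⟩ h' e; simp at h h' e ⊢; exact ⟨e, h.2.trans h'.2.symm⟩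
    · intro y hy; exact ⟨(y, z), by simpa using hy, rfl⟩
  have h2 : ∀ z, (Finset.univ.filter fun y => A y z).card = 1 + if TwoIn A z then 1 else 0 := by
    intro z
    split_ifs with h
    · obtain ⟨y, y', hne, h, h'⟩ := h
      rw [show 1 + 1 = ({y, y'} : Finset α).card from (Finset.card_pair hne).symm]
      congr 1
      ext w
      simp only [Finset.mem_filter_univ, Finset.mem_insert, Finset.mem_singleton]
      refine ⟨fun hw => ?_, ?_⟩
      · have := H.in_le_two h h' hw
        grind
      · rintro (rfl | rfl) <;> assumption
    · obtain ⟨y, hy⟩ := H.exists_in z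
      rw [add_zero, Finset.card_eq_one]
      refine ⟨y, ?_⟩
      ext w
      simp only [Finset.mem_filter_univ, Finset.mem_singleton]
      refine ⟨fun hw => ?_, fun e => e ▸ hy⟩
      by_contra hne
      exact h ⟨w, y, hne, hw, hy⟩
  rw [h1, Finset.sum_congr rfl (fun z _ => h2 z), Finset.sum_add_distrib]
  simp [Nat.card_eq_fintype_card, Fintype.card_subtype]

theorem card_arcs_le [Finite α] {p q : ℕ → α} {r s : ℕ}
    (h : ∀ a b, A a b → OnPath σ p r a b ∨ OnPath σ q s a b) :
    Nat.card {e : α × α // A e.1 e.2} ≤ 2 * r + 2 * s := by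
  classical
  have := Fintype.ofFinite α
  rw [Nat.card_eq_fintype_card, Fintype.card_subtype]
  let S (p : ℕ → α) (r : ℕ) : Finset (α × α) :=
    (Finset.range r).image (fun i => (p i, p (i + 1))) ∪
      (Finset.range r).image (fun i => (σ (p (i + 1)), σ (p i)))
  have hS : ∀ p r, (S p r).card ≤ 2 * r := fun p r => by
    refine (Finset.card_union_le _ _).trans ?_
    have h1 := Finset.card_image_le (s := Finset.range r) (f := fun i => (p i, p (i + 1)))
    have h2 := Finset.card_image_le (s := Finset.range r) (f := fun i => (σ (p (i + 1)), σ (p i)))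
    rw [Finset.card_range] at h1 h2
    omega
  have hmem : ∀ p r a b, OnPath σ p r a b → (a, b) ∈ S p r := by
    rintro p r _ _ ⟨i, hi, ⟨rfl, rfl⟩ | ⟨rfl, rfl⟩⟩
    · exact Finset.mem_union_left _ (Finset.mem_image.2 ⟨i, Finset.mem_range.2 hi, rfl⟩)
    · exact Finset.mem_union_right _ (Finset.mem_image.2 ⟨i, Finset.mem_range.2 hi, rfl⟩)
  calc _ ≤ (S p r ∪ S q s).card := Finset.card_le_card fun e he => by
        rcases h e.1 e.2 (by simpa using he) with h | h
        · exact Finset.mem_union_left _ (hmem _ _ _ _ h)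
        · exact Finset.mem_union_right _ (hmem _ _ _ _ h)
    _ ≤ _ := (Finset.card_union_le _ _).trans (add_le_add (hS p r) (hS q s))

/-- A triangle `b → x → σ b` with `b` the only predecessor of `x` forces deficiency one. -/
theorem not_adj_compl_of_pred [Finite α] (H : IsSkewMinimal A σ) {x b : α} (hx : ¬ TwoIn A x)
    (hbx : A b x) (hU : 2 < Nat.card {z // TwoIn A z}) : ¬ A x (σ b) := by
  intro hxb
  have huniq : ∀ z, A z x → z = b := fun z hz => by
    by_contra hzb; exact hx ⟨z, b, hzb, hz, hbx⟩
  have hout : ∀ z, A (σ x) z → z = σ b := fun z hz => by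
    have := huniq (σ z) (by simpa [H.invol] using H.skew hz)
    rw [← this, H.invol]
  have hxb' : x ≠ b := fun e => H.irrefl _ (e ▸ hbx)
  have hxσb : x ≠ σ b := fun e => H.irrefl _ (e ▸ hxb)
  obtain ⟨s, j, q, hjs, hq0, hq, hqv, hqs, hc⟩ :=
    H.lasso (p := fun t => if t = 0 then b else if t = 1 then x else σ b) (r := 2)
      (by intro i hi; interval_cases i <;> simpa) (by simp)
  simp only [if_true] at hq0
  -- The lasso from `σ b` avoids the variable of `x`: reaching `x` would require `b` first, and
  -- leaving `σ x` would lead back to `σ b`.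
  have hq_ne : ∀ t < s, q t ≠ x := by
    intro t ht e
    rcases t with _ | t
    · exact hxσb (e.symm.trans hq0)
    · have h1 := huniq (q t) (by rw [← e]; exact hq t (by omega))
      have := hqv t 0 (by omega) (by omega) (.inr (by rw [h1, hq0, H.invol]))
      subst this
      exact H.ne b (hq0.symm.trans h1)
  have hq_ne' : ∀ t < s, q t ≠ σ x := by
    intro t ht e
    have h1 := hout (q (t + 1)) (by rw [← e]; exact hq t ht)
    rcases Nat.lt_or_ge (t + 1) s with h | h
    · have := hqv (t + 1) 0 h (by omega) (.inl (by rw [h1, hq0]))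
      omega
    · obtain rfl : s = t + 1 := by omega
      have := hqv 0 j (by omega) hjs (.inr (by rw [hq0, ← hqs, h1]))
      subst this
      rw [hqs, hq0] at h1
      exact H.ne _ h1
  have hv : VarSimple σ (fun t => if t < s then q t else x) (s + 1) := by
    intro i j hi hj e
    dsimp only at e
    split_ifs at e with h1 h2 h2
    · exact hqv i j h1 h2 e
    · rcases e with e | e
      exacts [absurd e (hq_ne i h1), absurd e (hq_ne' i h1)]
    · rcases e with e | e
      exacts [absurd e.symm (hq_ne j h2), absurd (by rw [e, H.invol]) (hq_ne' j h2)]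
    · omega
  -- With the variable of `x` added, `2 * (s + 1) ≤ card α`, whereas the triangle and the lasso
  -- carry at most `4 + 2 * s` arcs. This leaves at most two vertices of in-degree two.
  have h1 := (hv.two_mul_le H.ne fun _ _ => H.inj).1
  have h2 := card_arcs_le hc
  have h3 := H.card_arcs
  omega

/-! ### The base case: all in-degrees are two -/

section Base

variable {k : ℕ}

/-- There are `4 * k` arcs, covered by the walk and a lasso with at most `2 * r + 2 * s` arcs. Since
`r` and `s` are at most `k`, both equal `k`. -/
theorem length_eq_of_varSimple [Finite α] (H : IsSkewMinimal A σ) (hU : ∀ z, TwoIn A z)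
    (hk : Nat.card α = 2 * k) {p : ℕ → α} {r : ℕ} (hp : IsPath A p r) (hpr : p r = σ (p 0))
    (hv : VarSimple σ p r) : r = k := by
  obtain ⟨s, j, q, hjs, hq0, hq, hqv, hqs, hc⟩ := H.lasso hp hpr
  have h1 := (hqv.two_mul_le H.ne fun _ _ => H.inj).1
  have h2 := card_arcs_le hc
  have h3 := H.card_arcs
  have h4 := (hv.two_mul_le H.ne fun _ _ => H.inj).1
  have h5 : Nat.card {z // TwoIn A z} = Nat.card α :=
    Nat.card_congr (Equiv.subtypeUnivEquiv hU)
  omega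

/-- The part of a lasso from `q j` to `q s = σ (q j)` is such a walk. -/
theorem exists_varSimple (H : IsSkewMinimal A σ) [Nonempty α] :
    ∃ (p : ℕ → α) (r : ℕ), IsPath A p r ∧ p r = σ (p 0) ∧ VarSimple σ p r := by
  obtain ⟨x⟩ := ‹Nonempty α›
  obtain ⟨n, p, hp0, hpn, hp, -⟩ := exists_simple_path (H.conn x (σ x))
  obtain ⟨s, j, q, hjs, -, hq, hqv, hqs, -⟩ := H.lasso hp (by rw [hpn, hp0])
  refine ⟨fun t => q (j + t), s - j, fun i hi => hq _ (by omega), ?_,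
    hqv.mono (m := j) (by omega) fun _ _ => rfl⟩
  simp only [add_zero]
  rw [← hqs]; congr 1; omega

/-- Every vertex is some `p t` or `σ (p t)`. An arc to `p t` has contrapositive `σ (p t) → p 0`; put
in front of `p 0, …, p t`, it gives a walk of length `t + 1`, so `t = k - 1`. An arc to `σ (p t)`,
appended to `p t, …, p k`, gives length `k - t + 1`, so `t = 1`. Both arcs exist because the
out-degree is two. -/
theorem out_of_compl [Finite α] (H : IsSkewMinimal A σ) (hnu : NoUnit A σ) (hU : ∀ z, TwoIn A z)
    (hk : Nat.card α = 2 * k) {p : ℕ → α} (hp : IsPath A p k) (hpk : p k = σ (p 0))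
    (hv : VarSimple σ p k) (z : α) :
    A (σ (p 0)) z ↔ z = p (k - 1) ∨ z = σ (p 1) := by
  have key : ∀ z, A (σ (p 0)) z → z = p (k - 1) ∨ z = σ (p 1) := by
    intro z hz
    obtain ⟨t, ht, rfl | rfl⟩ := (hv.two_mul_le H.ne fun _ _ => H.inj).2 hk.symm z
    · have ht0 : t ≠ 0 := by
        rintro rfl
        exact hnu _ (by rw [H.invol]; exact hz)
      left
      have hz' : A (σ (p t)) (p 0) := by simpa [H.invol] using H.skew hz
      have := H.length_eq_of_varSimple hU hk (r := t + 1)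
        (p := fun i => if i = 0 then σ (p t) else p (i - 1)) ?_ ?_ ?_
      · rw [← this]; rfl
      · intro i hi
        rcases i with _ | i
        · simpa using hz'
        · simpa using hp i (by omega)
      · simp [H.invol]
      · intro i j hi hj e
        rcases i with _ | i <;> rcases j with _ | j
        · rfl
        · simp only [if_true, Nat.add_eq_zero_iff, one_ne_zero, and_false, if_false,
            Nat.add_sub_cancel] at e
          have := hv t j ht (by omega) (by
            rcases e with e | e
            exacts [.inr (by rw [← e, H.invol]), .inl (H.inj e)])
          omega
        · simp only [if_true, Nat.add_eq_zero_iff, one_ne_zero, and_false, if_false,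
            Nat.add_sub_cancel] at e
          have := hv i t (by omega) ht (by
            rcases e with e | e
            exacts [.inr e, .inl (by rw [e, H.invol])])
          omega
        · simp only [Nat.add_eq_zero_iff, one_ne_zero, and_false, if_false,
            Nat.add_sub_cancel] at e
          rw [hv i j (by omega) (by omega) e]
    · have ht0 : t ≠ 0 := by
        rintro rfl
        exact H.irrefl _ hz
      right
      have := H.length_eq_of_varSimple hU hk (r := k - t + 1)
        (p := fun i => if i = k - t + 1 then σ (p t) else p (t + i)) ?_ ?_ ?_
      · rw [show t = 1 by omega]
      · intro i hi
        simp only [show i ≠ k - t + 1 by omega, if_false]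
        split_ifs with h
        · rw [show t + i = k by omega, hpk]; exact hz
        · exact hp (t + i) (by omega)
      · simp
      · intro i j hi hj e
        simp only [show i ≠ k - t + 1 by omega, show j ≠ k - t + 1 by omega, if_false] at e
        rcases Nat.lt_or_ge (t + i) k with hi' | hi' <;> rcases Nat.lt_or_ge (t + j) k with hj' | hj'
        · have := hv _ _ hi' hj' e
          omega
        · rw [show t + j = k by omega, hpk, H.invol] at e
          have := hv _ 0 hi' (by omega) e.symm
          omega
        · rw [show t + i = k by omega, hpk] at e
          have := hv 0 _ (by omega) hj' (by
            rcases e with e | e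
            exacts [.inr (by rw [← e, H.invol]), .inl (H.inj e)])
          omega
        · omega
  refine ⟨key z, ?_⟩
  obtain ⟨y, y', hne, h, h'⟩ := H.twoIn_skew_iff.1 (hU (σ (σ (p 0))))
  have e1 := key _ h
  have e2 := key _ h'
  rintro (rfl | rfl)
  · rcases e1 with rfl | rfl
    · exact h
    · rcases e2 with rfl | rfl
      · exact h'
      · exact absurd rfl hne
  · rcases e1 with rfl | rfl
    · rcases e2 with rfl | rfl
      · exact absurd rfl hne
      · exact h'
    · exact h

/-- If all in-degrees are two, then the digraph is a double cycle with antipodal complement. -/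
theorem exists_double_cycle [Finite α] (H : IsSkewMinimal A σ) (hnu : NoUnit A σ)
    (hU : ∀ z, TwoIn A z) (hk2 : 2 ≤ k) (hk : Nat.card α = 2 * k) :
    ∃ e : ZMod (2 * k) ≃ α, (∀ i j, A (e i) (e j) ↔ j = i + 1 ∨ i = j + 1) ∧
      ∀ i, σ (e i) = e (i + k) := by
  have : Nonempty α := (Nat.card_pos_iff.1 (by omega)).1
  have : NeZero (2 * k) := ⟨by omega⟩
  obtain ⟨p, r, hp, hpr, hv⟩ := H.exists_varSimple
  obtain rfl := H.length_eq_of_varSimple hU hk hp hpr hv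
  rename' r => k
  -- The walk is continued antipodally, with `c (i + k) = σ (c i)`.
  let c : ℕ → α := fun i => σ^[i / k] (p (i % k))
  have hck : ∀ i, c (i + k) = σ (c i) := fun i => by
    simp only [c, Nat.add_div_right _ (show 0 < k by omega), Nat.add_mod_right,
      Function.iterate_succ_apply']
  have hσ : ∀ m z, σ^[m] z = z ∨ σ^[m] z = σ z := by
    intro m z
    induction m with
    | zero => exact .inl rfl
    | succ m ih =>
      rw [Function.iterate_succ_apply']
      rcases ih with h | h <;> rw [h]
      · exact .inr rfl
      · exact .inl (H.invol z)
  have hcv : ∀ i, VarSimple σ (fun t => c (i + t)) k := by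
    intro i a b ha hb e
    have h1 := hσ ((i + a) / k) (p ((i + a) % k))
    have h2 := hσ ((i + b) / k) (p ((i + b) % k))
    have hI := @H.inj
    have h3 := hv ((i + a) % k) ((i + b) % k) (Nat.mod_lt _ (by omega)) (Nat.mod_lt _ (by omega))
      (by
        simp only [c] at e
        have := H.invol
        rcases h1 with h1 | h1 <;> rcases h2 with h2 | h2 <;> rw [h1, h2] at e <;> grind)
    have h4 : a ≡ b [MOD k] := Nat.ModEq.add_left_cancel' i h3
    rwa [Nat.ModEq, Nat.mod_eq_of_lt ha, Nat.mod_eq_of_lt hb] at h4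
  have hc0 : ∀ t ≤ k, c t = p t := by
    intro t ht
    rcases ht.lt_or_eq with h | rfl
    · simp [c, Nat.mod_eq_of_lt h, Nat.div_eq_of_lt h]
    · simp [c, Nat.div_self (show 0 < t by omega), hpr]
  have hcp : ∀ i, IsPath A (fun t => c (i + t)) k := by
    intro i
    induction i with
    | zero =>
      intro t ht
      simp only [zero_add]
      rw [hc0 t (by omega), hc0 (t + 1) (by omega)]
      exact hp t ht
    | succ i ih =>
      intro t ht
      rcases Nat.lt_or_ge (t + 1) k with h | h
      · have := ih (t + 1) h
        simpa only [show i + 1 + t = i + (t + 1) by omega,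
          show i + 1 + (t + 1) = i + (t + 1 + 1) by omega] using this
      -- The only new arc of the shifted window goes from `σ (c i)` to `σ (c (i + 1))`.
      · have := (H.out_of_compl hnu hU hk ih (hck i) (hcv i) (σ (c (i + 1)))).2 (.inr rfl)
        simp only [add_zero, ← hck] at this
        simpa only [show i + 1 + t = i + k by omega,
          show i + 1 + (t + 1) = i + 1 + k by omega] using this
  have hper : Function.Periodic c (2 * k) := fun i => by
    rw [two_mul, ← add_assoc, hck, hck, H.invol]
  have hout : ∀ i z, A (c (i + 1)) z ↔ z = c i ∨ z = c (i + 2) := by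
    intro i z
    -- The window starts at `i + 1 + k`, so that the complement of its first vertex is `c (i + 1)`.
    have := H.out_of_compl hnu hU hk (hcp (i + 1 + k)) (hck _) (hcv _) z
    simp only [add_zero, ← hck] at this
    rw [show i + 1 + k + k = i + 1 + 2 * k by omega, hper,
      show i + 1 + k + (k - 1) = i + 2 * k by omega, hper,
      show i + 1 + k + 1 + k = i + 2 + 2 * k by omega, hper] at this
    exact this
  let e : ZMod (2 * k) → α := fun i => c i.val
  have he : ∀ i : ℕ, e (i : ZMod (2 * k)) = c i := fun i => by
    simp only [e, ZMod.val_natCast]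
    exact hper.map_mod_nat i
  have hsur : Function.Surjective e := by
    intro z
    obtain ⟨t, ht, h | h⟩ := (hv.two_mul_le H.ne fun _ _ => H.inj).2 hk.symm z
    · exact ⟨(t : ℕ), by rw [he, h, hc0 t ht.le]⟩
    · exact ⟨((t + k : ℕ) : ZMod (2 * k)), by rw [he, hck, h, hc0 t ht.le]⟩
  have hbij : Function.Bijective e :=
    (Nat.bijective_iff_surjective_and_card e).2 ⟨hsur, by rw [hk, Nat.card_zmod]⟩
  refine ⟨Equiv.ofBijective e hbij, fun i j => ?_, fun i => ?_⟩
  · obtain ⟨a, ha⟩ : ∃ a : ℕ, i = ((a + 1 : ℕ) : ZMod (2 * k)) :=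
      ⟨(i - 1).val, by push_cast; rw [ZMod.natCast_zmod_val]; ring⟩
    simp only [Equiv.ofBijective_apply]
    rw [ha, he, hout, ← he a, ← he (a + 2), hbij.1.eq_iff, hbij.1.eq_iff]
    push_cast
    constructor
    · rintro (rfl | rfl)
      · exact .inr rfl
      · left; ring
    · rintro (rfl | h)
      · right; ring
      · left; exact (add_right_cancel h).symm
  · obtain ⟨a, rfl⟩ : ∃ a : ℕ, i = (a : ZMod (2 * k)) := ⟨i.val, by rw [ZMod.natCast_zmod_val]⟩
    simp only [Equiv.ofBijective_apply]
    rw [he, ← hck, ← he]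
    push_cast; rfl

end Base

end IsSkewMinimal

end TwoMU

/-! ### Labellings and their transport along collapses -/

namespace TwoMU

/-- A labelling of the vertices by positions on a cycle of length `m`: a vertex with a single
predecessor has the same label as this predecessor, the two predecessors of any other vertex have
the two neighbouring labels, and every label belongs to exactly one vertex of in-degree two. -/
structure IsLabeling {α : Type u} (A : α → α → Prop) (m : ℕ) (h : α → ZMod m) : Prop where
  eq_pred : ∀ {y z}, A y z → ¬ TwoIn A z → h z = h y
  preds : ∀ {y y' z}, A y z → A y' z → y ≠ y' →
    (h y = h z + 1 ∧ h y' = h z - 1) ∨ (h y = h z - 1 ∧ h y' = h z + 1)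
  bij : Set.BijOn h {z | TwoIn A z} Set.univ

/-- `c` collapses a digraph onto another one by contracting arcs into vertices of in-degree one;
`inn` selects in each fibre the vertex that receives the arcs from outside of the fibre. -/
structure IsCollapse {α β : Type u} (A : α → α → Prop) (A' : β → β → Prop) (c : α → β)
    (inn : β → α) : Prop where
  left : ∀ v, c (inn v) = v
  right : ∀ {z}, TwoIn A z → inn (c z) = z
  lift : ∀ {u v}, A' u v → ∃ y, c y = u ∧ A y (inn v)
  arc : ∀ {y z}, A y z → c y = c z ∧ ¬ TwoIn A z ∨ inn (c z) = z ∧ A' (c y) (c z)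
  sep : ∀ {y y' z}, A y z → A y' z → y ≠ y' → c y ≠ c y'

namespace IsCollapse

variable {α β : Type u} {A : α → α → Prop} {A' : β → β → Prop} {c : α → β} {inn : β → α}

theorem twoIn (K : IsCollapse A A' c inn) {z : α} (hz : TwoIn A z) : TwoIn A' (c z) := by
  obtain ⟨y, y', hne, h, h'⟩ := hz
  have hz : TwoIn A z := ⟨y, y', hne, h, h'⟩
  refine ⟨c y, c y', K.sep h h' hne, ?_, ?_⟩
  · exact ((K.arc h).resolve_left fun e => e.2 hz).2
  · exact ((K.arc h').resolve_left fun e => e.2 hz).2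

theorem twoIn_inn (K : IsCollapse A A' c inn) {v : β} (hv : TwoIn A' v) : TwoIn A (inn v) := by
  obtain ⟨u, u', hne, h, h'⟩ := hv
  obtain ⟨y, rfl, hy⟩ := K.lift h
  obtain ⟨y', rfl, hy'⟩ := K.lift h'
  exact ⟨y, y', fun e => hne (e ▸ rfl), hy, hy'⟩

theorem card_eq (K : IsCollapse A A' c inn) :
    Nat.card {z // TwoIn A z} = Nat.card {v // TwoIn A' v} :=
  Nat.card_congr
    { toFun := fun z => ⟨c z.1, K.twoIn z.2⟩
      invFun := fun v => ⟨inn v.1, K.twoIn_inn v.2⟩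
      left_inv := fun z => Subtype.ext (K.right z.2)
      right_inv := fun v => Subtype.ext (K.left v.1) }

theorem isLabeling (K : IsCollapse A A' c inn) {m : ℕ} {h : β → ZMod m}
    (hh : IsLabeling A' m h) : IsLabeling A m (h ∘ c) where
  eq_pred {y z} hyz hz := by
    rcases K.arc hyz with h | ⟨h1, h2⟩
    · simp [h.1]
    · exact hh.eq_pred h2 fun h3 => hz (h1 ▸ K.twoIn_inn h3)
  preds {y y' z} hy hy' hne := by
    have hz : TwoIn A z := ⟨y, y', hne, hy, hy'⟩
    exact hh.preds ((K.arc hy).resolve_left fun e => e.2 hz).2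
      ((K.arc hy').resolve_left fun e => e.2 hz).2 (K.sep hy hy' hne)
  bij := by
    refine ⟨fun _ _ => trivial, ?_, ?_⟩
    · intro z hz z' hz' e
      have := hh.bij.injOn (K.twoIn hz) (K.twoIn hz') e
      rw [← K.right hz, this, K.right hz']
    · intro i _
      obtain ⟨v, hv, rfl⟩ := hh.bij.surjOn (Set.mem_univ i)
      exact ⟨inn v, K.twoIn_inn hv, by simp [K.left]⟩

end IsCollapse

theorem DigraphIso.of_bijective {α β : Type*} {G : Digraph α} {H : Digraph β} (f : α → β)
    (hf : Function.Bijective f) (h : ∀ a b, G.Adj a b ↔ H.Adj (f a) (f b)) : DigraphIso G H :=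
  ⟨Equiv.ofBijective f hf, h⟩

theorem isWDC_of_double_cycle {α : Type u} {A : α → α → Prop} {n : ℕ} (hn : 3 ≤ n)
    (e : ZMod n ≃ α) (he : ∀ i j, A (e i) (e j) ↔ j = i + 1 ∨ i = j + 1) :
    IsWDC n (⟨A⟩ : Digraph α) := by
  -- In this form `ZMod n` unfolds to the `Fin` type on which the cycle graph lives.
  obtain ⟨m, rfl⟩ : ∃ m, n = m + 2 := ⟨n - 2, by omega⟩
  refine .doubleCycle _ hn ⟨e, fun a b => ?_⟩
  refine Iff.trans ?_ (he a b).symm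
  change (SimpleGraph.cycleGraph (m + 2)).Adj a b ↔ _
  rw [SimpleGraph.cycleGraph_adj]
  constructor
  · rintro (h | h)
    · right; exact (sub_eq_iff_eq_add'.1 h).trans (add_comm _ _) |>.trans (add_comm _ _)
    · left; exact (sub_eq_iff_eq_add'.1 h).trans (add_comm _ _) |>.trans (add_comm _ _)
  · rintro (h | h)
    · right; exact sub_eq_iff_eq_add'.2 h
    · left; exact sub_eq_iff_eq_add'.2 h

/-! ### Contraction at a vertex of in-degree one -/

section Contract

variable {α : Type u} {A : α → α → Prop} {σ : α → α}

/-- The contraction of the arcs `b → x` and `σ x → σ b`, keeping `b` and `σ b`. -/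
def contract (A : α → α → Prop) (σ : α → α) (x b : α) (u v : {z // z ≠ x ∧ z ≠ σ x}) : Prop :=
  A u v ∨ (u = b ∧ A x v) ∨ (v = σ b ∧ A u (σ x))

/-- The complement on the remaining vertices after a contraction. -/
def IsSkewMinimal.contractCompl (H : IsSkewMinimal A σ) (x : α) (z : {z // z ≠ x ∧ z ≠ σ x}) :
    {z // z ≠ x ∧ z ≠ σ x} :=
  ⟨σ z, fun e => z.2.2 (H.eq_iff.1 e), fun e => z.2.1 (H.inj e)⟩

open Classical in
/-- The map that sends `x` to `w` and `σ x` to `w'`. -/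
noncomputable def collapse (σ : α → α) (x : α) (w w' : {z // z ≠ x ∧ z ≠ σ x}) (z : α) :
    {z // z ≠ x ∧ z ≠ σ x} :=
  if h : z = x then w else if h' : z = σ x then w' else ⟨z, h, h'⟩

theorem collapse_self {x : α} {w w' : {z // z ≠ x ∧ z ≠ σ x}} :
    collapse σ x w w' x = w := by
  simp [collapse]

theorem collapse_compl {x : α} {w w' : {z // z ≠ x ∧ z ≠ σ x}} (hx : σ x ≠ x) :
    collapse σ x w w' (σ x) = w' := by
  simp [collapse, hx]

theorem collapse_coe {x : α} {w w' : {z // z ≠ x ∧ z ≠ σ x}} (z : {z // z ≠ x ∧ z ≠ σ x}) :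
    collapse σ x w w' z = z := by
  simp [collapse, z.2.1, z.2.2]

theorem collapse_of_ne {x z : α} {w w' : {z // z ≠ x ∧ z ≠ σ x}} (h : z ≠ x) (h' : z ≠ σ x) :
    collapse σ x w w' z = ⟨z, h, h'⟩ := by
  simp [collapse, h, h']

/-- The vertex `x` has the single predecessor `b`, and the situation is not degenerate. -/
structure IsContractible (A : α → α → Prop) (σ : α → α) (x b : α) : Prop where
  skewMinimal : IsSkewMinimal A σ
  noUnit : NoUnit A σ
  adj_iff : ∀ {z}, A z x ↔ z = b
  not_back : ¬ A x b
  not_compl : ¬ A x (σ b)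

theorem IsSkewMinimal.isContractible [Finite α] (H : IsSkewMinimal A σ) (hnu : NoUnit A σ)
    (hU : 2 < Nat.card {z // TwoIn A z}) {x : α} (hx : ¬ TwoIn A x) :
    ∃ b, IsContractible A σ x b := by
  obtain ⟨b, hb⟩ := H.exists_in x
  refine ⟨b, H, hnu, fun {z} => ⟨fun hz => ?_, fun e => e ▸ hb⟩,
    H.not_adj_back hx hb ?_, H.not_adj_compl_of_pred hx hb hU⟩
  · by_contra hzb; exact hx ⟨z, b, hzb, hz, hb⟩
  · rintro rfl
    exact hnu (σ x) (by rwa [H.invol])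

namespace IsContractible

variable {x b : α}

theorem adj (C : IsContractible A σ x b) : A b x := C.adj_iff.2 rfl

theorem compl_adj_iff (C : IsContractible A σ x b) {z : α} : A (σ x) z ↔ z = σ b := by
  rw [← C.skewMinimal.skew_iff, C.skewMinimal.invol, C.adj_iff, C.skewMinimal.eq_iff]

theorem ne_pred (C : IsContractible A σ x b) : b ≠ x ∧ b ≠ σ x :=
  ⟨fun e => C.skewMinimal.irrefl x (C.adj_iff.2 e.symm),
    fun e => C.noUnit (σ x) (by rw [C.skewMinimal.invol]; exact C.adj_iff.2 e.symm)⟩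

theorem ne_compl_pred (C : IsContractible A σ x b) : σ b ≠ x ∧ σ b ≠ σ x :=
  ⟨fun e => C.ne_pred.2 (C.skewMinimal.eq_iff.1 e), fun e => C.ne_pred.1 (C.skewMinimal.inj e)⟩

/-- The walk `b → x → z` would bypass `b → z`. Hence merging `x` into `b` identifies no two outgoing
arcs. -/
theorem not_adj_both (C : IsContractible A σ x b) {z : α} (h : A x z) : ¬ A b z :=
  C.skewMinimal.not_adj_of_bypass C.adj h C.ne_pred.2 fun e => C.noUnit x (e ▸ h)

theorem not_both_adj (C : IsContractible A σ x b) {z : α} (h : A z (σ x)) : ¬ A z (σ b) := by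
  have H := C.skewMinimal
  intro h'
  exact C.not_adj_both (z := σ z) (by simpa [H.invol] using H.skew h)
    (by simpa [H.invol] using H.skew h')

theorem not_adj_compl (C : IsContractible A σ x b) : ¬ A b (σ x) := fun h =>
  C.not_compl (by simpa [C.skewMinimal.invol] using C.skewMinimal.skew h)

theorem contract_ne (C : IsContractible A σ x b) {u v : {z // z ≠ x ∧ z ≠ σ x}}
    (h : contract A σ x b u v) : u ≠ v := by
  rintro rfl
  rcases h with h | ⟨h, h'⟩ | ⟨h, h'⟩
  · exact C.skewMinimal.irrefl _ h
  · rw [h] at h'; exact C.not_back h'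
  · rw [h] at h'
    exact C.not_back (by simpa [C.skewMinimal.invol] using C.skewMinimal.skew h')

theorem contract_noUnit (C : IsContractible A σ x b) :
    NoUnit (contract A σ x b) (C.skewMinimal.contractCompl x) := by
  have H := C.skewMinimal
  rintro u (h | ⟨h, h'⟩ | ⟨h, h'⟩)
  · exact C.noUnit _ h
  · simp only [IsSkewMinimal.contractCompl, h] at h'
    exact C.not_compl h'
  · rw [H.inj h] at h'
    exact C.not_adj_compl h'

/-- The contraction map commutes with complements and sends each arc to a point or to an arc, so
connectivity descends. For minimality, closed walks in the contraction are lifted back to `A`. -/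
theorem contract_skewMinimal (C : IsContractible A σ x b) :
    IsSkewMinimal (contract A σ x b) (C.skewMinimal.contractCompl x) := by
  have H := C.skewMinimal
  let c := collapse σ x ⟨b, C.ne_pred⟩ ⟨σ b, C.ne_compl_pred⟩
  have cx : c x = ⟨b, C.ne_pred⟩ := collapse_self
  have cx' : c (σ x) = ⟨σ b, C.ne_compl_pred⟩ := collapse_compl (H.ne x)
  have cc : ∀ z : {z // z ≠ x ∧ z ≠ σ x}, c z = z := collapse_coe
  have cne : ∀ {z} (h : z ≠ x) (h' : z ≠ σ x), c z = ⟨z, h, h'⟩ := collapse_of_ne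
  have cσ : ∀ z, c (σ z) = C.skewMinimal.contractCompl x (c z) := by
    intro z
    by_cases h : z = x
    · subst h; rw [cx, cx']; rfl
    · by_cases h' : z = σ x
      · subst h'; rw [H.invol, cx, cx']
        exact Subtype.ext (H.invol b).symm
      · rw [cne h h', cne (fun e => h' (H.eq_iff.1 e)) (fun e => h (H.inj e))]; rfl
  have carc : ∀ {u v}, A u v → c u = c v ∨ contract A σ x b (c u) (c v) := by
    intro u v h
    by_cases h1 : v = x
    · subst h1
      rw [C.adj_iff] at h; subst h
      left; rw [cx, cne C.ne_pred.1 C.ne_pred.2]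
    by_cases h2 : u = σ x
    · subst h2
      rw [C.compl_adj_iff] at h; subst h
      left; rw [cx', cne C.ne_compl_pred.1 C.ne_compl_pred.2]
    right
    by_cases h3 : u = x
    · subst h3
      have h4 : v ≠ σ u := by rintro rfl; exact C.noUnit _ h
      rw [cx, cne h1 h4]
      exact .inr (.inl ⟨rfl, h⟩)
    rw [cne h3 h2]
    by_cases h4 : v = σ x
    · subst h4
      rw [cx']
      exact .inr (.inr ⟨rfl, h⟩)
    rw [cne h1 h4]
    exact .inl h
  have hskew : ∀ {u v}, contract A σ x b u v → contract A σ x b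
      (C.skewMinimal.contractCompl x v) (C.skewMinimal.contractCompl x u) := by
    rintro u v (h | ⟨h, h'⟩ | ⟨h, h'⟩)
    · exact .inl (H.skew h)
    · exact .inr (.inr ⟨congrArg σ h, H.skew h'⟩)
    · refine .inr (.inl ⟨H.eq_iff.2 h, ?_⟩)
      have := H.skew h'
      rwa [H.invol] at this
  refine ⟨fun z => Subtype.ext (H.invol _), fun z e => H.ne _ (congrArg Subtype.val e), hskew, ?_,
    ?_⟩
  · intro u v
    rw [← cc u, ← cc v]
    refine ReflTransGen.lift' c ?_ _ _ (H.conn u v)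
    intro a d had
    rcases carc had with h | h
    · change ReflTransGen _ (c a) (c d)
      rw [h]
    · exact .single h
  · intro B hBA hBs z h1 h2
    -- The preimage of `B`, together with the collapsed arcs. Each arc of `B` lifts to a walk in
    -- `B'`, through `x` or `σ x` if necessary.
    let B' : α → α → Prop := fun u v => A u v ∧ (c u = c v ∨ B (c u) (c v))
    have hlift : ∀ u v, B u v → ReflTransGen B' u v := by
      intro u v huv
      rcases hBA u v huv with h | ⟨h, h'⟩ | ⟨h, h'⟩
      · exact .single ⟨h, .inr (by rwa [cc, cc])⟩
      · have s1 : B' u x := ⟨by rw [h]; exact C.adj, .inl (by rw [cc, cx]; exact Subtype.ext h)⟩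
        have s2 : B' x v := ⟨h', .inr (by
          rw [cc, cx, show (⟨b, C.ne_pred⟩ : {z // z ≠ x ∧ z ≠ σ x}) = u from Subtype.ext h.symm]
          exact huv)⟩
        exact (ReflTransGen.single s1).tail s2
      · have s2 : B' (σ x) v :=
          ⟨by rw [h, H.skew_iff]; exact C.adj, .inl (by rw [cc, cx']; exact Subtype.ext h.symm)⟩
        have s1 : B' u (σ x) := ⟨h', .inr (by
          rw [cc, cx', show (⟨σ b, C.ne_compl_pred⟩ : {z // z ≠ x ∧ z ≠ σ x}) = v from
            Subtype.ext h.symm]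
          exact huv)⟩
        exact (ReflTransGen.single s1).tail s2
    have hl : ∀ u v, ReflTransGen B u v → ReflTransGen B' u v :=
      ReflTransGen.lift' Subtype.val hlift
    have key := H.minimal B' (fun _ _ h => h.1) (fun u v h => ⟨H.skew h.1, by
      rw [cσ, cσ]
      rcases h.2 with h | h
      · exact .inl (by rw [h])
      · exact .inr (hBs _ _ h)⟩) z (hl _ _ h1) (hl _ _ h2)
    intro u v huv
    have hne := C.contract_ne huv
    rcases huv with h | ⟨h, h'⟩ | ⟨h, h'⟩
    · have := (key _ _ h).2
      rw [cc, cc] at this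
      exact this.resolve_left hne
    · have := (key _ _ h').2
      rw [cc, cx, show (⟨b, C.ne_pred⟩ : {z // z ≠ x ∧ z ≠ σ x}) = u from Subtype.ext h.symm] at this
      exact this.resolve_left hne
    · have := (key _ _ h').2
      rw [cc, cx', show (⟨σ b, C.ne_compl_pred⟩ : {z // z ≠ x ∧ z ≠ σ x}) = v from
            Subtype.ext h.symm] at this
      exact this.resolve_left hne

end IsContractible

end Contract

end TwoMU

/-! ### Undoing a contraction by splittings -/

namespace TwoMU

namespace IsContractible

variable {α : Type u} {A : α → α → Prop} {σ : α → α} {x b : α}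

theorem compl_adj (C : IsContractible A σ x b) : A (σ x) (σ b) := C.compl_adj_iff.2 rfl

theorem not_twoIn (C : IsContractible A σ x b) : ¬ TwoIn A x := by
  rintro ⟨y, y', hne, h, h'⟩
  exact hne ((C.adj_iff.1 h).trans (C.adj_iff.1 h').symm)

/-! #### The vertex `x` has a single successor: two arc splittings -/

section Arc

variable {d : α}

theorem succ_ne (C : IsContractible A σ x b) (hd : ∀ z, A x z ↔ z = d) :
    d ≠ x ∧ d ≠ σ x ∧ d ≠ b ∧ d ≠ σ b := by
  have hxd := (hd d).2 rfl
  refine ⟨?_, ?_, ?_, ?_⟩ <;> rintro rfl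
  exacts [C.skewMinimal.irrefl _ hxd, C.noUnit _ hxd, C.not_back hxd, C.not_compl hxd]

theorem compl_succ_ne (C : IsContractible A σ x b) (hd : ∀ z, A x z ↔ z = d) :
    σ d ≠ x ∧ σ d ≠ σ x :=
  ⟨fun e => (C.succ_ne hd).2.1 (C.skewMinimal.eq_iff.1 e),
    fun e => (C.succ_ne hd).1 (C.skewMinimal.inj e)⟩

theorem adj_compl_iff (C : IsContractible A σ x b) (hd : ∀ z, A x z ↔ z = d) {z : α} :
    A z (σ x) ↔ z = σ d := by
  have H := C.skewMinimal
  rw [← H.skew_iff, H.invol, hd, H.eq_iff]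

theorem contract_iff_of_succ (C : IsContractible A σ x b) (hd : ∀ z, A x z ↔ z = d)
    {u v : {z // z ≠ x ∧ z ≠ σ x}} :
    contract A σ x b u v ↔ A u v ∨ (u = b ∧ v = d) ∨ (v = σ b ∧ u = σ d) := by
  simp only [contract, hd, C.adj_compl_iff hd]

/-- A collapse absorbs a vertex into its only predecessor. Here this is `σ d` for `σ x`, so `σ x`
goes to `σ d` rather than to `σ b`; both absorbed vertices have in-degree one and receive no arcs in
the collapsed digraph. -/
theorem arc_isCollapse (C : IsContractible A σ x b) (hd : ∀ z, A x z ↔ z = d) :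
    IsCollapse A (contract A σ x b) (collapse σ x ⟨b, C.ne_pred⟩ ⟨σ d, C.compl_succ_ne hd⟩)
      Subtype.val := by
  have H := C.skewMinimal
  set c := collapse σ x ⟨b, C.ne_pred⟩ ⟨σ d, C.compl_succ_ne hd⟩
  have cx : c x = ⟨b, C.ne_pred⟩ := collapse_self
  have cx' : c (σ x) = ⟨σ d, C.compl_succ_ne hd⟩ := collapse_compl (H.ne x)
  have cc : ∀ z : {z // z ≠ x ∧ z ≠ σ x}, c z = z := collapse_coe
  have cne : ∀ {z} (h : z ≠ x) (h' : z ≠ σ x), c z = ⟨z, h, h'⟩ := collapse_of_ne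
  have hnu' : ¬ TwoIn A (σ x) := by
    rintro ⟨y, y', hne, h, h'⟩
    exact hne (((C.adj_compl_iff hd).1 h).trans ((C.adj_compl_iff hd).1 h').symm)
  obtain ⟨d1, d2, d3, d4⟩ := C.succ_ne hd
  obtain ⟨d5, d6⟩ := C.compl_succ_ne hd
  have hxd := (hd d).2 rfl
  have hbd := C.not_adj_both hxd
  have hbd' := C.not_both_adj ((C.adj_compl_iff hd).2 rfl)
  refine ⟨cc, ?_, ?_, ?_, ?_⟩
  · intro z hz
    rw [cne (fun e => C.not_twoIn (e ▸ hz)) (fun e => hnu' (e ▸ hz))]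
  · intro u v huv
    rcases (C.contract_iff_of_succ hd).1 huv with h | ⟨h, h'⟩ | ⟨h, h'⟩
    · exact ⟨u, cc u, h⟩
    · exact ⟨x, by rw [cx]; exact Subtype.ext h.symm, by rw [h']; exact hxd⟩
    · exact ⟨σ x, by rw [cx']; exact Subtype.ext h'.symm, by rw [h]; exact C.compl_adj⟩
  · intro y z hyz
    by_cases h1 : z = x
    · subst h1
      rw [C.adj_iff] at hyz; subst hyz
      exact .inl ⟨by rw [cx, cne C.ne_pred.1 C.ne_pred.2], C.not_twoIn⟩
    by_cases h2 : z = σ x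
    · subst h2
      rw [C.adj_compl_iff hd] at hyz; subst hyz
      exact .inl ⟨by rw [cx', cne d5 d6], hnu'⟩
    right
    rw [cne h1 h2, C.contract_iff_of_succ hd]
    refine ⟨rfl, ?_⟩
    by_cases h3 : y = x
    · subst h3
      rw [cx]
      exact .inr (.inl ⟨rfl, (hd z).1 hyz⟩)
    by_cases h4 : y = σ x
    · subst h4
      rw [cx']
      exact .inr (.inr ⟨C.compl_adj_iff.1 hyz, rfl⟩)
    rw [cne h3 h4]
    exact .inl hyz
  · have aux : ∀ {y z}, A y z → A x z → y ≠ x → c y ≠ c x := by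
      intro y z hy hx hne e
      obtain rfl := (hd z).1 hx
      by_cases h : y = σ x
      · subst h
        exact d4 (C.compl_adj_iff.1 hy)
      · rw [cx, cne hne h] at e
        rw [show y = b from congrArg Subtype.val e] at hy
        exact hbd hy
    have aux' : ∀ {y z}, A y z → A (σ x) z → y ≠ σ x → c y ≠ c (σ x) := by
      intro y z hy hx hne e
      obtain rfl := C.compl_adj_iff.1 hx
      by_cases h : y = x
      · subst h
        exact C.not_compl hy
      · rw [cx', cne h hne] at e
        rw [show y = σ d from congrArg Subtype.val e] at hy
        exact hbd' hy
    intro y y' z hy hy' hne e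
    by_cases h1 : y' = x
    · subst h1; exact aux hy hy' hne e
    by_cases h2 : y' = σ x
    · subst h2; exact aux' hy hy' hne e
    by_cases h3 : y = x
    · subst h3; exact aux hy' hy hne.symm e.symm
    by_cases h4 : y = σ x
    · subst h4; exact aux' hy' hy hne.symm e.symm
    rw [cne h1 h2, cne h3 h4] at e
    exact hne (congrArg Subtype.val e)

/-- The vertex `x` splits `b → d`, and `σ x` splits `σ d → σ b`. These arcs are distinct since `d ≠
σ b`, and neither is an arc of `A`, so the splittings restore `A` exactly. -/
theorem arc_isWDC (C : IsContractible A σ x b) (hd : ∀ z, A x z ↔ z = d) {m : ℕ}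
    (h : IsWDC m (⟨contract A σ x b⟩ : Digraph _)) : IsWDC m (⟨A⟩ : Digraph α) := by
  have H := C.skewMinimal
  obtain ⟨d1, d2, d3, d4⟩ := C.succ_ne hd
  have hxd := (hd d).2 rfl
  have hbd := C.not_adj_both hxd
  have hbd' := C.not_both_adj ((C.adj_compl_iff hd).2 rfl)
  let b₁ : {z // z ≠ x ∧ z ≠ σ x} := ⟨b, C.ne_pred⟩
  let b₂ : {z // z ≠ x ∧ z ≠ σ x} := ⟨σ b, C.ne_compl_pred⟩
  let d₁ : {z // z ≠ x ∧ z ≠ σ x} := ⟨d, d1, d2⟩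
  let d₂ : {z // z ≠ x ∧ z ≠ σ x} := ⟨σ d, C.compl_succ_ne hd⟩
  have hA := fun u v => C.contract_iff_of_succ hd (u := u) (v := v)
  have h1 := IsWDC.splitArc _ b₁ d₁ ((hA _ _).2 (.inr (.inl ⟨rfl, rfl⟩))) _ h
    ⟨Equiv.refl _, fun _ _ => Iff.rfl⟩
  refine IsWDC.splitArc _ (some d₂) (some b₂) ?_ _ h1 ?_
  · refine ⟨fun e => d4 ?_, (hA _ _).2 (.inr (.inr ⟨rfl, rfl⟩))⟩
    exact (H.eq_iff.1 (congrArg Subtype.val e.1))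
  let f : Option (Option {z // z ≠ x ∧ z ≠ σ x}) → α
    | none => σ x
    | some none => x
    | some (some a) => a
  refine .of_bijective f ⟨?_, ?_⟩ ?_
  · rintro (_ | _ | u) (_ | _ | v) e
    · rfl
    · exact absurd e (H.ne x)
    · exact absurd e.symm v.2.2
    · exact absurd e.symm (H.ne x)
    · rfl
    · exact absurd e.symm v.2.1
    · exact absurd e u.2.2
    · exact absurd e u.2.1
    · exact congrArg (some ∘ some) (Subtype.ext e)
  · intro z
    by_cases h1 : z = x
    · exact ⟨some none, h1.symm⟩
    by_cases h2 : z = σ x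
    · exact ⟨none, h2.symm⟩
    exact ⟨some (some ⟨z, h1, h2⟩), rfl⟩
  · have e1 : ∀ u v : {z // z ≠ x ∧ z ≠ σ x}, u = v ↔ u.1 = v.1 := fun _ _ => Subtype.ext_iff
    rintro (_ | _ | u) (_ | _ | v)
    · simp [splitArc, f, H.irrefl]
    · have := C.noUnit (σ x); rw [H.invol] at this
      simp [splitArc, f, this]
    · simp [splitArc, f, C.compl_adj_iff, b₂, e1]
    · simp [splitArc, f, C.noUnit x]
    · simp [splitArc, f, H.irrefl]
    · simp [splitArc, f, hd, d₁, e1]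
    · simp [splitArc, f, C.adj_compl_iff hd, d₂, e1]
    · simp [splitArc, f, C.adj_iff, b₁, e1]
    · simp only [splitArc, f, hA, b₁, b₂, d₁, d₂, Option.some.injEq, e1]
      constructor
      · rintro ⟨h1, h2, h3 | h3 | h3⟩
        exacts [h3, absurd h3 h2, absurd h3.symm h1]
      · intro h
        refine ⟨?_, ?_, .inl h⟩
        · rintro ⟨h1, h2⟩; rw [h1, h2] at h; exact hbd' h
        · rintro ⟨h1, h2⟩; rw [h1, h2] at h; exact hbd h

end Arc

/-! #### The vertex `x` has two successors: two vertex splittings -/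

section Vertex

/-- Another successor of `b`, together with the two of `x`, would give `b` three successors in the
contraction, which is skew-minimal. -/
theorem pred_out [Finite α] (C : IsContractible A σ x b) (hx : TwoIn A (σ x)) {z : α} :
    A b z ↔ z = x := by
  have H := C.skewMinimal
  refine ⟨fun hz => ?_, fun e => e ▸ C.adj⟩
  by_contra hzx
  obtain ⟨y, y', hne, h, h'⟩ := H.twoIn_skew_iff.1 hx
  have hn : ∀ {y}, A x y → y ≠ x ∧ y ≠ σ x := fun {y} h =>
    ⟨fun e => H.irrefl x (by rwa [e] at h), fun e => C.noUnit x (by rwa [e] at h)⟩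
  have hz2 : z ≠ σ x := fun e => C.not_adj_compl (e ▸ hz)
  obtain ⟨a₁, a₂, ha⟩ := C.contract_skewMinimal.out_le_two ⟨b, C.ne_pred⟩
  have e1 := ha ⟨z, hzx, hz2⟩ (.inl hz)
  have e2 := ha ⟨y, hn h⟩ (.inr (.inl ⟨rfl, h⟩))
  have e3 := ha ⟨y', hn h'⟩ (.inr (.inl ⟨rfl, h'⟩))
  have n1 : y ≠ z := fun e => C.not_adj_both h (e ▸ hz)
  have n2 : y' ≠ z := fun e => C.not_adj_both h' (e ▸ hz)
  rcases e1 with rfl | rfl <;> rcases e2 with e2 | e2 <;> rcases e3 with e3 | e3 <;>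
    simp_all [Subtype.ext_iff]

open Classical in
/-- The vertex of the fibre of `v` that receives the arcs from outside. -/
noncomputable def entry (σ : α → α) (x b : α) (v : {z // z ≠ x ∧ z ≠ σ x}) : α :=
  if v.1 = σ b then σ x else v

open Classical in
/-- The vertex of the fibre of `v` from which the arcs lead outside. -/
noncomputable def exit (σ : α → α) (x b : α) (v : {z // z ≠ x ∧ z ≠ σ x}) : α :=
  if v.1 = b then x else v

theorem entry_eq {v : {z // z ≠ x ∧ z ≠ σ x}} {z : α} :
    entry σ x b v = z ↔ (v.1 = σ b ∧ z = σ x) ∨ (z ≠ σ b ∧ v.1 = z) := by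
  unfold entry
  split_ifs with h
  · rw [h]; grind
  · grind

theorem exit_eq {v : {z // z ≠ x ∧ z ≠ σ x}} {z : α} :
    exit σ x b v = z ↔ (v.1 = b ∧ z = x) ∨ (z ≠ b ∧ v.1 = z) := by
  unfold exit
  split_ifs with h
  · rw [h]; grind
  · grind

/-- The fibres are `b → x` and `σ x → σ b`. By `pred_out`, arcs leave the first only from `x`, and
by skew-symmetry they enter the second only at `σ x`. -/
theorem contract_iff_entry [Finite α] (C : IsContractible A σ x b) (hx : TwoIn A (σ x))
    {u v : {z // z ≠ x ∧ z ≠ σ x}} :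
    contract A σ x b u v ↔ A (exit σ x b u) (entry σ x b v) := by
  have H := C.skewMinimal
  have hσb : ∀ {z}, A z (σ b) ↔ z = σ x := fun {z} => by
    rw [← H.skew_iff, H.invol, C.pred_out hx, H.eq_iff]
  unfold entry exit contract
  have h1 := v.2.1
  have h2 := u.2.2
  have h3 := C.noUnit x
  have h4 := C.not_compl
  have h5 := C.not_adj_compl
  have h6 := C.ne_compl_pred
  have h7 := H.ne b
  split_ifs with hu hv hv
  · simp only [hu, hv, h3, h4, h5, C.pred_out hx, h6.1, true_and, or_self]
  · simp only [hu, hv, C.pred_out hx, h1, true_and, false_and, or_false, false_or]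
  · simp only [hu, hv, hσb, h2, true_and, false_and, false_or]
  · simp only [hu, hv, false_and, or_false]

theorem vertex_isCollapse [Finite α] (C : IsContractible A σ x b) (hx : TwoIn A (σ x)) :
    IsCollapse A (contract A σ x b) (collapse σ x ⟨b, C.ne_pred⟩ ⟨σ b, C.ne_compl_pred⟩)
      (entry σ x b) := by
  have H := C.skewMinimal
  set c := collapse σ x ⟨b, C.ne_pred⟩ ⟨σ b, C.ne_compl_pred⟩
  have cx : c x = ⟨b, C.ne_pred⟩ := collapse_self
  have cx' : c (σ x) = ⟨σ b, C.ne_compl_pred⟩ := collapse_compl (H.ne x)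
  have cc : ∀ z : {z // z ≠ x ∧ z ≠ σ x}, c z = z := collapse_coe
  have cne : ∀ {z} (h : z ≠ x) (h' : z ≠ σ x), c z = ⟨z, h, h'⟩ := collapse_of_ne
  have hσb : ∀ {z}, A z (σ b) ↔ z = σ x := fun {z} => by
    rw [← H.skew_iff, H.invol, C.pred_out hx, H.eq_iff]
  have hnu' : ¬ TwoIn A (σ b) := by
    rintro ⟨y, y', hne, h, h'⟩
    exact hne ((hσb.1 h).trans (hσb.1 h').symm)
  have hentry : ∀ {z}, z ≠ x → z ≠ σ b → entry σ x b (c z) = z := by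
    intro z h1 h2
    rw [entry_eq]
    by_cases h : z = σ x
    · subst h; rw [cx']; exact .inl ⟨rfl, rfl⟩
    · rw [cne h1 h]; exact .inr ⟨h2, rfl⟩
  have hexit : ∀ {z}, z ≠ b → z ≠ σ x → exit σ x b (c z) = z := by
    intro z h1 h2
    rw [exit_eq]
    by_cases h : z = x
    · subst h; rw [cx]; exact .inl ⟨rfl, rfl⟩
    · rw [cne h h2]; exact .inr ⟨h1, rfl⟩
  have hcexit : ∀ u, c (exit σ x b u) = u := by
    intro u
    unfold exit
    split_ifs with h
    · rw [cx]; exact Subtype.ext h.symm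
    · exact cc u
  have hcentry : ∀ u, c (entry σ x b u) = u := by
    intro u
    unfold entry
    split_ifs with h
    · rw [cx']; exact Subtype.ext h.symm
    · exact cc u
  have hpred : ∀ {y z}, A y z → z ≠ x → z ≠ σ b → exit σ x b (c y) = y := by
    intro y z h h1 h2
    refine hexit ?_ ?_
    · rintro rfl; exact h1 ((C.pred_out hx).1 h)
    · rintro rfl; exact h2 (C.compl_adj_iff.1 h)
  refine ⟨hcentry, ?_, ?_, ?_, ?_⟩
  · intro z hz
    exact hentry (fun e => C.not_twoIn (e ▸ hz)) (fun e => hnu' (e ▸ hz))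
  · intro u v huv
    exact ⟨exit σ x b u, hcexit u, (C.contract_iff_entry hx).1 huv⟩
  · intro y z hyz
    by_cases h1 : z = x
    · subst h1
      rw [C.adj_iff] at hyz; subst hyz
      exact .inl ⟨by rw [cx, cne C.ne_pred.1 C.ne_pred.2], C.not_twoIn⟩
    by_cases h2 : z = σ b
    · subst h2
      rw [hσb] at hyz; subst hyz
      exact .inl ⟨by rw [cx', cne C.ne_compl_pred.1 C.ne_compl_pred.2], hnu'⟩
    right
    rw [C.contract_iff_entry hx, hentry h1 h2, hpred hyz h1 h2]
    exact ⟨rfl, hyz⟩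
  · intro y y' z hy hy' hne e
    have hz : TwoIn A z := ⟨y, y', hne, hy, hy'⟩
    have h1 : z ≠ x := fun e => C.not_twoIn (e ▸ hz)
    have h2 : z ≠ σ b := fun e => hnu' (e ▸ hz)
    exact hne (by rw [← hpred hy h1 h2, e, hpred hy' h1 h2])

theorem vertex_isWDC [Finite α] (C : IsContractible A σ x b) (hx : TwoIn A (σ x)) {m : ℕ}
    (h : IsWDC m (⟨contract A σ x b⟩ : Digraph _)) : IsWDC m (⟨A⟩ : Digraph α) := by
  have H := C.skewMinimal
  have hσb : ∀ {z}, A z (σ b) ↔ z = σ x := fun {z} => by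
    rw [← H.skew_iff, H.invol, C.pred_out hx, H.eq_iff]
  let b₁ : {z // z ≠ x ∧ z ≠ σ x} := ⟨b, C.ne_pred⟩
  let b₂ : {z // z ≠ x ∧ z ≠ σ x} := ⟨σ b, C.ne_compl_pred⟩
  have hA := fun u v => C.contract_iff_entry hx (u := u) (v := v)
  have h1 := IsWDC.splitVertex _ b₁ _ h ⟨Equiv.refl _, fun _ _ => Iff.rfl⟩
  refine IsWDC.splitVertex _ (some b₂) _ h1 ?_
  -- A vertex splitting adds the end from which arcs leave: this is `x` for `b`, but `σ b` for the
  -- second fibre, whose old name now stands for `σ x`.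
  let f : Option (Option {z // z ≠ x ∧ z ≠ σ x}) → α
    | none => σ b
    | some none => x
    | some (some a) => entry σ x b a
  have hex : ∀ v, entry σ x b v ≠ x := by
    intro v e
    rcases entry_eq.1 e with ⟨_, h⟩ | ⟨_, h⟩
    exacts [H.ne x h.symm, v.2.1 h]
  have heb : ∀ v, entry σ x b v ≠ σ b := by
    intro v e
    rcases entry_eq.1 e with ⟨_, h⟩ | ⟨h, _⟩
    exacts [C.ne_compl_pred.2 h, h rfl]
  refine .of_bijective f ⟨?_, ?_⟩ ?_
  · rintro (_ | _ | u) (_ | _ | v) e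
    · rfl
    · exact absurd e C.ne_compl_pred.1
    · exact absurd e.symm (heb v)
    · exact absurd e.symm C.ne_compl_pred.1
    · rfl
    · exact absurd e.symm (hex v)
    · exact absurd e (heb u)
    · exact absurd e (hex u)
    · have := congrArg (collapse σ x ⟨b, C.ne_pred⟩ ⟨σ b, C.ne_compl_pred⟩) e
      simp only [f, (C.vertex_isCollapse hx).left] at this
      rw [this]
  · intro z
    by_cases h1 : z = x
    · exact ⟨some none, h1.symm⟩
    by_cases h2 : z = σ b
    · exact ⟨none, h2.symm⟩
    by_cases h3 : z = σ x
    · exact ⟨some (some b₂), entry_eq.2 (.inl ⟨rfl, h3⟩)⟩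
    exact ⟨some (some ⟨z, h1, h3⟩), entry_eq.2 (.inr ⟨h2, rfl⟩)⟩
  · have e1 : ∀ u v : {z // z ≠ x ∧ z ≠ σ x}, u = v ↔ u.1 = v.1 := fun _ _ => Subtype.ext_iff
    have n1 := H.ne b
    have n2 := C.ne_compl_pred
    have n3 := C.ne_pred
    have n4 := H.ne x
    have xb₁ : exit σ x b b₁ = x := exit_eq.2 (.inl ⟨rfl, rfl⟩)
    have xb₂ : exit σ x b b₂ = σ b := exit_eq.2 (.inr ⟨n1, rfl⟩)
    rintro (_ | _ | u) (_ | _ | v)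
    · simp [splitVertex, f, H.irrefl]
    · simp [splitVertex, f, C.adj_iff, e1, b₁, b₂, n1]
    · simp [splitVertex, f, hA, xb₂, e1, b₁, n1, show b₂.1 = σ b from rfl]
    · simp [splitVertex, f, hσb, n4.symm]
    · simp [splitVertex, f, H.irrefl]
    · simp [splitVertex, f, hA, xb₁]
    · simp only [splitVertex, f, hσb, entry_eq, Option.some.injEq, e1, b₂]
      have := u.2.2
      tauto
    · simp only [splitVertex, f, C.adj_iff, entry_eq, ne_eq, Option.some.injEq, e1, b₁, b₂]
      grind
    · simp only [splitVertex, f, hA, ne_eq, Option.some.injEq, e1, b₁, b₂]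
      by_cases h1 : u.1 = σ b
      · simp only [h1, not_true, false_and, false_iff]
        rw [entry_eq.2 (.inl ⟨h1, rfl⟩), C.compl_adj_iff]
        exact heb v
      · by_cases h2 : u.1 = b
        · simp only [h2, not_true, false_and, and_false, false_iff]
          rw [entry_eq.2 (.inr ⟨n1.symm, h2⟩), C.pred_out hx]
          exact hex v
        · rw [entry_eq.2 (.inr ⟨h1, rfl⟩), exit_eq.2 (.inr ⟨h2, rfl⟩)]
          simp [h1, h2]

end Vertex

end IsContractible

/-! ### The structure theorem -/

namespace IsSkewMinimal

variable {α : Type u} {A : α → α → Prop} {σ : α → α}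

/-- A vertex of in-degree one yields a smaller digraph of the same kind. -/
theorem exists_collapse [Finite α] (H : IsSkewMinimal A σ) (hnu : NoUnit A σ)
    (hU : 2 < Nat.card {z // TwoIn A z}) {x : α} (hx : ¬ TwoIn A x) :
    ∃ (β : Type u) (A' : β → β → Prop) (τ : β → β) (c : α → β) (inn : β → α), Finite β ∧
      Nat.card β < Nat.card α ∧ IsSkewMinimal A' τ ∧ NoUnit A' τ ∧ IsCollapse A A' c inn ∧
      (∀ z, TwoIn A z → c (σ z) = τ (c z)) ∧
      ∀ m, IsWDC m (⟨A'⟩ : Digraph β) → IsWDC m (⟨A⟩ : Digraph α) := by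
  obtain ⟨b, C⟩ := H.isContractible hnu hU hx
  have hcard : Nat.card {z // z ≠ x ∧ z ≠ σ x} < Nat.card α := by
    have := Fintype.ofFinite α
    classical
    rw [Nat.card_eq_fintype_card, Nat.card_eq_fintype_card]
    exact Fintype.card_subtype_lt (x := x) (by simp)
  -- By skew-symmetry this asks whether `x` has two successors.
  by_cases h2 : TwoIn A (σ x)
  · have K := C.vertex_isCollapse h2
    refine ⟨_, _, _, _, _, inferInstance, hcard, C.contract_skewMinimal, C.contract_noUnit, K,
      fun z hz => ?_, fun m => C.vertex_isWDC h2⟩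
    by_cases h : z = σ x
    · subst h
      rw [H.invol, collapse_self, collapse_compl (H.ne x)]
      exact Subtype.ext (H.invol b).symm
    · have h' : z ≠ x := fun e => hx (e ▸ hz)
      rw [collapse_of_ne h' h, collapse_of_ne (fun e => h (H.eq_iff.1 e)) fun e => h' (H.inj e)]
      rfl
  · obtain ⟨d, hd⟩ := H.exists_out x
    have hd' : ∀ z, A x z ↔ z = d := fun z => ⟨fun hz => by
      by_contra hne
      exact h2 (H.twoIn_skew_iff.2 ⟨z, d, hne, hz, hd⟩), fun e => e ▸ hd⟩
    have K := C.arc_isCollapse hd'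
    refine ⟨_, _, _, _, _, inferInstance, hcard, C.contract_skewMinimal, C.contract_noUnit, K,
      fun z hz => ?_, fun m => C.arc_isWDC hd'⟩
    have h' : z ≠ x := fun e => hx (e ▸ hz)
    have h : z ≠ σ x := fun e => h2 (e ▸ hz)
    rw [collapse_of_ne h' h, collapse_of_ne (fun e => h (H.eq_iff.1 e)) fun e => h' (H.inj e)]
    rfl

/-- The structure theorem: `2k`-weak-double-cycles, and the labelling by positions, in which
complementation is the antipodal map on the vertices of in-degree two. -/
theorem isWDC_and_exists_labeling {k : ℕ} (hk : 2 ≤ k) [Finite α] (H : IsSkewMinimal A σ)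
    (hnu : NoUnit A σ) (hU : Nat.card {z // TwoIn A z} = 2 * k) :
    IsWDC (2 * k) (⟨A⟩ : Digraph α) ∧ ∃ h : α → ZMod (2 * k), IsLabeling A (2 * k) h ∧
      ∀ z, TwoIn A z → h (σ z) = h z + k := by
  induction hn : Nat.card α using Nat.strong_induction_on generalizing α with
  | _ n ih =>
    by_cases hall : ∀ z, TwoIn A z
    · have hc : Nat.card α = 2 * k := by
        rw [← hU]; exact (Nat.card_congr (Equiv.subtypeUnivEquiv hall)).symm
      obtain ⟨e, he, heσ⟩ := H.exists_double_cycle hnu hall hk hc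
      have he' : ∀ a b, A a b ↔ e.symm b = e.symm a + 1 ∨ e.symm a = e.symm b + 1 := fun a b => by
        rw [← he, e.apply_symm_apply, e.apply_symm_apply]
      refine ⟨isWDC_of_double_cycle (by omega) e he, e.symm, ⟨?_, ?_, ?_⟩, fun z _ => ?_⟩
      · intro y z _ hz
        exact absurd (hall z) hz
      · intro y y' z h h' hne
        have hne' : e.symm y ≠ e.symm y' := fun e' => hne (e.symm.injective e')
        rcases (he' _ _).1 h with h | h <;> rcases (he' _ _).1 h' with h' | h'
        · exact absurd (add_right_cancel (h.symm.trans h')) hne'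
        · right; exact ⟨by rw [h]; ring, h'⟩
        · left; exact ⟨h, by rw [h']; ring⟩
        · exact absurd (h.trans h'.symm) hne'
      · refine ⟨fun _ _ => trivial, e.symm.injective.injOn, fun i _ => ⟨e i, hall _, by simp⟩⟩
      · rw [Equiv.symm_apply_eq, ← heσ, e.apply_symm_apply]
    · push Not at hall
      obtain ⟨x, hx⟩ := hall
      obtain ⟨β, A', τ, c, inn, hfin, hcard, H', hnu', K, hc, hW⟩ :=
        H.exists_collapse hnu (by omega) hx
      obtain ⟨h1, h, h2, h3⟩ := ih _ (hn ▸ hcard) H' hnu' (K.card_eq ▸ hU) rfl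
      refine ⟨hW _ h1, h ∘ c, K.isLabeling h2, fun z hz => ?_⟩
      simp only [Function.comp_apply, hc z hz, h3 _ (K.twoIn hz)]

end IsSkewMinimal

end TwoMU

/-! ### Uniqueness of the labelling and of the complementation -/

namespace TwoMU

section Uniqueness

variable {α : Type u} {A : α → α → Prop} {σ : α → α}

theorem twoIn_congr {β : Type u} {A' : β → β → Prop} (f : α ≃ β)
    (hf : ∀ a b, A a b ↔ A' (f a) (f b)) {z : α} : TwoIn A z ↔ TwoIn A' (f z) := by
  constructor
  · rintro ⟨y, y', hne, h, h'⟩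
    exact ⟨f y, f y', fun e => hne (f.injective e), (hf _ _).1 h, (hf _ _).1 h'⟩
  · rintro ⟨y, y', hne, h, h'⟩
    exact ⟨f.symm y, f.symm y', fun e => hne (f.symm.injective e), (hf _ _).2 (by simpa),
      (hf _ _).2 (by simpa)⟩

theorem IsLabeling.comp_equiv {β : Type u} {A' : β → β → Prop} {m : ℕ} {h : β → ZMod m}
    (hh : IsLabeling A' m h) (f : α ≃ β) (hf : ∀ a b, A a b ↔ A' (f a) (f b)) :
    IsLabeling A m (h ∘ f) where
  eq_pred hyz hz := hh.eq_pred ((hf _ _).1 hyz) fun h => hz ((twoIn_congr f hf).2 h)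
  preds hy hy' hne := hh.preds ((hf _ _).1 hy) ((hf _ _).1 hy') fun e => hne (f.injective e)
  bij := by
    refine ⟨fun _ _ => trivial, fun z hz z' hz' e => ?_, fun i _ => ?_⟩
    · exact f.injective (hh.bij.injOn ((twoIn_congr f hf).1 hz) ((twoIn_congr f hf).1 hz') e)
    · obtain ⟨v, hv, rfl⟩ := hh.bij.surjOn (Set.mem_univ i)
      exact ⟨f.symm v, (twoIn_congr f hf).2 (by simpa), by simp⟩

theorem natCast_add_self_eq_zero (k : ℕ) : (k : ZMod (2 * k)) + k = 0 := by
  rw [← Nat.cast_add, ← two_mul, ZMod.natCast_self]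

/-- Two labellings of a strongly connected digraph differ by an injective map that commutes with
the antipodal map. -/
theorem IsLabeling.exists_comp {k : ℕ} {h h' : α → ZMod (2 * k)}
    (hconn : ∀ x y, ReflTransGen A x y) (hh : IsLabeling A (2 * k) h)
    (hh' : IsLabeling A (2 * k) h') :
    ∃ g : ZMod (2 * k) → ZMod (2 * k), Function.Injective g ∧ (∀ z, h' z = g (h z)) ∧
      ∀ i, g (i + k) = g i + k := by
  choose v hv hvi using fun i => hh.bij.surjOn (Set.mem_univ i)
  have hvh : ∀ z, TwoIn A z → v (h z) = z := fun z hz => hh.bij.injOn (hv _) hz (hvi _)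
  -- Both labels are inherited along arcs into vertices of in-degree one, so `h'` depends only on
  -- `h`.
  have hg : ∀ z, h' z = h' (v (h z)) := by
    intro z
    induction hconn (v 0) z with
    | refl => rw [hvi]
    | @tail y z _ hyz ih =>
      by_cases hz : TwoIn A z
      · rw [hvh z hz]
      · rw [hh.eq_pred hyz hz, hh'.eq_pred hyz hz, ih]
  -- The predecessors of `v i` have the labels `i ± 1` under `h`, and the two neighbours of `h' (v
  -- i)` under `h'`. So `g` has constant differences, equal to 1 or -1.
  have hstep : ∀ i, h' (v (i + 1)) - h' (v i) = h' (v i) - h' (v (i - 1)) ∧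
      (h' (v (i + 1)) - h' (v i) = 1 ∨ h' (v (i + 1)) - h' (v i) = -1) := by
    intro i
    obtain ⟨y, y', hne, hy, hy'⟩ := hv i
    have e1 := hh.preds hy hy' hne
    have e2 := hh'.preds hy hy' hne
    rw [hg y, hg y', hvi] at *
    rcases e1 with ⟨e1, e1'⟩ | ⟨e1, e1'⟩ <;> rw [e1, e1'] at e2 <;>
      rcases e2 with ⟨e2, e2'⟩ | ⟨e2, e2'⟩ <;> rw [e2, e2'] <;>
      first
        | exact ⟨by ring1, .inl (by ring1)⟩
        | exact ⟨by ring1, .inr (by ring1)⟩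
  have hlin : ∀ i, ∀ n : ℕ, h' (v (i + n + 1)) - h' (v (i + n)) = h' (v (i + 1)) - h' (v i) ∧
      h' (v (i + n)) = h' (v i) + n * (h' (v (i + 1)) - h' (v i)) := by
    intro i n
    induction n with
    | zero => simp
    | succ n ih =>
      push_cast
      refine ⟨?_, ?_⟩
      · rw [(hstep _).1, show i + (n + 1 : ZMod (2 * k)) - 1 = i + n by ring, ← add_assoc, ih.1]
      · rw [← add_assoc, ← sub_add_cancel (h' (v (i + n + 1))) (h' (v (i + n))), ih.1, ih.2]
        ring
  refine ⟨fun i => h' (v i), fun i j e => ?_, hg, fun i => ?_⟩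
  · rw [← hvi i, hh'.bij.injOn (hv i) (hv j) e, hvi]
  · simp only
    rw [(hlin i k).2]
    rcases (hstep i).2 with e | e <;> rw [e]
    · ring
    · linear_combination -natCast_add_self_eq_zero k

/-- The complementation is determined by the digraph. -/
theorem IsSkewMinimal.compl_unique {k : ℕ} (hk : 2 ≤ k) (H : IsSkewMinimal A σ) {σ' : α → α}
    (hinv : ∀ x, σ' (σ' x) = x) (hskew : ∀ {x y}, A x y → A (σ' y) (σ' x))
    {h h' : α → ZMod (2 * k)} (hh : IsLabeling A (2 * k) h) (hh' : IsLabeling A (2 * k) h')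
    (hσ : ∀ z, TwoIn A z → h (σ z) = h z + k) (hσ' : ∀ z, TwoIn A z → h' (σ' z) = h' z + k)
    (z : α) : σ z = σ' z := by
  obtain ⟨g, hg, hgh, hgk⟩ := hh.exists_comp H.conn hh'
  have hcomp : ∀ z, TwoIn A z → h (σ' z) = h z + k := fun z hz => hg (by
    rw [← hgh, hσ' z hz, hgk, hgh])
  have hinj' : ∀ {x y}, σ' x = σ' y → x = y := fun {x y} e => by rw [← hinv x, e, hinv]
  have hadj : ∀ {x y}, A x y → A (σ (σ' x)) (σ (σ' y)) := fun h => H.skew (hskew h)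
  have htwo : ∀ {z}, TwoIn A (σ (σ' z)) ↔ TwoIn A z := by
    intro z
    constructor
    · rintro ⟨y, y', hne, e, e'⟩
      refine ⟨σ' (σ y), σ' (σ y'), fun e => hne (H.inj (hinj' e)), ?_, ?_⟩
      · have := hskew (H.skew e)
        rwa [H.invol, hinv] at this
      · have := hskew (H.skew e')
        rwa [H.invol, hinv] at this
    · rintro ⟨y, y', hne, e, e'⟩
      exact ⟨_, _, fun e => hne (hinj' (H.inj e)), hadj e, hadj e'⟩
  -- Both complementations add `k` to `h` on vertices of in-degree two, where `h` is injective.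
  have hfix : ∀ z, TwoIn A z → σ (σ' z) = z := by
    intro z hz
    refine hh.bij.injOn (htwo.2 hz) hz ?_
    have e := hσ _ (htwo.2 hz)
    rw [H.invol, hcomp z hz] at e
    exact (add_right_cancel e).symm
  obtain ⟨u, hu, -⟩ := hh.bij.surjOn (Set.mem_univ 0)
  have hlab : ∀ z, h (σ (σ' z)) = h z := by
    intro z
    induction H.conn u z with
    | refl => rw [hfix u hu]
    | @tail y z _ hyz ih =>
      by_cases hz : TwoIn A z
      · rw [hfix z hz]
      · rw [hh.eq_pred hyz hz, hh.eq_pred (hadj hyz) (fun e => hz (htwo.1 e)), ih]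
  have hall : ∀ z, σ (σ' z) = z := by
    intro z
    induction H.conn u z with
    | refl => exact hfix u hu
    | @tail y z _ hyz ih =>
      by_contra hne
      have h1 : A y (σ (σ' z)) := by simpa [ih] using hadj hyz
      -- If `z` and `σ (σ' z)` were different successors of `y`, then `σ z` and `σ' z` would be
      -- different predecessors of `σ y`, with labels differing by 2. By `hlab` these labels agree,
      -- although `2 ≠ 0` modulo `2 * k`.
      have e := hh.preds (H.skew h1) (H.skew hyz) fun e => hne (H.inj e)
      have e2 := hlab (σ' z)
      rw [hinv] at e2
      rw [H.invol, ← e2] at e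
      have h2 : (2 : ZMod (2 * k)) ≠ 0 := by
        intro e
        have := (ZMod.natCast_eq_zero_iff 2 (2 * k)).1 (by exact_mod_cast e)
        have := Nat.le_of_dvd (by norm_num) this
        omega
      rcases e with ⟨e, e'⟩ | ⟨e, e'⟩
      · exact h2 (by linear_combination e' - e)
      · exact h2 (by linear_combination e - e')
  exact (H.eq_iff.1 (hall z)).symm

end Uniqueness

end TwoMU

/-! ### The 2-SAT theorem -/

namespace TwoMU

/-- The digraph form of the 2-SAT theorem. -/
theorem exists_consistent_closed {α : Type u} [Finite α] {A : α → α → Prop} {σ : α → α}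
    (hinv : ∀ x, σ (σ x) = x) (hskew : ∀ x y, A x y → A (σ y) (σ x))
    (h : ∀ x, ReflTransGen A x (σ x) → ¬ ReflTransGen A (σ x) x) :
    ∃ S : Set α, (∀ x y, A x y → x ∈ S → y ∈ S) ∧ ∀ x, x ∈ S ↔ σ x ∉ S := by
  let P : Set (Set α) := {S | (∀ x y, A x y → x ∈ S → y ∈ S) ∧ ∀ x, x ∈ S → σ x ∉ S}
  obtain ⟨S, hS⟩ := (Set.toFinite P).exists_maximal ⟨∅, by simp [P]⟩
  obtain ⟨hcl, hcons⟩ := hS.prop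
  have hclosed : ∀ x y, ReflTransGen A x y → x ∈ S → y ∈ S := by
    intro x y hxy hx
    induction hxy with
    | refl => exact hx
    | tail _ hbc ih => exact hcl _ _ hbc ih
  -- Adding everything reachable from `x` keeps a maximal `S` closed and consistent, so `x` was
  -- already in it.
  have hext : ∀ x, σ x ∉ S → ¬ ReflTransGen A x (σ x) → x ∈ S := by
    intro x h1 h2
    have hle : S ⊆ S ∪ {y | ReflTransGen A x y} := Set.subset_union_left
    refine hS.le_of_ge (y := S ∪ {y | ReflTransGen A x y}) ⟨?_, ?_⟩ hle (.inr .refl)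
    · rintro a b hab (ha | ha)
      · exact .inl (hcl a b hab ha)
      · exact .inr (ReflTransGen.tail ha hab)
    · have hs : ∀ {a b}, ReflTransGen A a b → ReflTransGen A (σ b) (σ a) :=
        reflTransGen_skew hskew
      rintro a (ha | ha) (hb | hb)
      · exact hcons a ha hb
      · have := hs hb
        rw [hinv] at this
        exact h1 (hclosed _ _ this ha)
      · exact h1 (hclosed _ _ (hs ha) hb)
      · have := hs hb
        rw [hinv] at this
        exact h2 (ReflTransGen.trans ha this)
  refine ⟨S, hcl, fun x => ⟨hcons x, fun hx => ?_⟩⟩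
  by_cases h1 : ReflTransGen A x (σ x)
  · by_contra hx'
    refine hx (hext (σ x) (by rwa [hinv]) ?_)
    rw [hinv]
    exact h x h1
  · exact hext x hx h1

/-! ### From 2-MUs to skew-minimal digraphs -/

section ClauseSets

theorem compl_compl {V : Type u} (x : Lit V) : compl (compl x) = x := by
  simp [compl]

theorem compl_ne {V : Type u} (x : Lit V) : compl x ≠ x := by
  intro h
  have := congrArg Prod.snd h
  simp [compl] at this

variable {V : Type u} [DecidableEq V] {F : ClauseSet V}

theorem pair_eq_pair {a b c d : Lit V} (h : ({a, b} : Finset (Lit V)) = {c, d}) :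
    a = c ∧ b = d ∨ a = d ∧ b = c := by
  rw [← Set.pair_eq_pair_iff]
  simpa using congrArg (fun s : Finset (Lit V) => (s : Set (Lit V))) h

theorem mem_lits {x : Lit V} : x ∈ lits F ↔ ∃ C ∈ F, ∃ y ∈ C, y.1 = x.1 := by
  simp [lits, vars]

theorem compl_mem_lits {x : Lit V} (h : x ∈ lits F) : compl x ∈ lits F :=
  mem_lits.2 (by simpa only [compl] using mem_lits.1 h)

theorem mem_lits_of_mem {C : Finset (Lit V)} (hC : C ∈ F) {x : Lit V} (hx : x ∈ C) :
    x ∈ lits F :=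
  mem_lits.2 ⟨C, hC, x, hx, rfl⟩

/-- Complementation of the literals of `F`. -/
def litCompl (F : ClauseSet V) (x : {x : Lit V // x ∈ lits F}) : {x : Lit V // x ∈ lits F} :=
  ⟨compl x, compl_mem_lits x.2⟩

theorem litCompl_litCompl (x : {x : Lit V // x ∈ lits F}) : litCompl F (litCompl F x) = x :=
  Subtype.ext (compl_compl _)

theorem idg_adj {a b : {x : Lit V // x ∈ lits F}} :
    (idg F).Adj a b ↔ ({compl a.1, b.1} : Finset (Lit V)) ∈ F := Iff.rfl

theorem idg_skew {a b : {x : Lit V // x ∈ lits F}} (h : (idg F).Adj a b) :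
    (idg F).Adj (litCompl F b) (litCompl F a) := by
  rw [idg_adj] at h ⊢
  simpa only [litCompl, compl_compl, Finset.pair_comm] using h

/-- Unit clauses are covered by `y = x`. -/
theorem IsTwoMU.exists_pair (hF : IsTwoMU F) {C : Finset (Lit V)} (hC : C ∈ F) {x : Lit V}
    (hx : x ∈ C) : ∃ y, C = {x, y} := by
  have h1 := hF.2.2 C hC
  have h2 : (C.erase x).card ≤ 1 := by rw [Finset.card_erase_of_mem hx]; omega
  have : Nonempty (Lit V) := ⟨x⟩
  obtain ⟨y, hy⟩ := Finset.card_le_one_iff_subset_singleton.1 h2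
  rcases Finset.subset_singleton_iff.1 hy with h | h
  · exact ⟨x, by rw [← Finset.insert_erase hx, h]; simp⟩
  · exact ⟨y, by rw [← Finset.insert_erase hx, h]⟩

theorem card_lits : Nat.card {x : Lit V // x ∈ lits F} = 2 * (vars F).card := by
  rw [Nat.card_eq_fintype_card, Fintype.card_coe]
  simp [lits, mul_comm]

/-- The empty clause is unsatisfiable on its own, so by minimality it would be the only clause, and
the deficiency at most one. -/
theorem IsTwoMU.empty_notMem (hF : IsTwoMU F) {k : ℕ} (hk : 2 ≤ k)
    (hδ : deficiency F = (k : ℤ)) : ∅ ∉ F := by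
  intro h
  have h1 : F ⊆ {∅} := by
    intro C hC
    by_contra hne
    obtain ⟨τ, hτ⟩ := hF.2.1.2 C hC
    obtain ⟨x, hx, -⟩ := hτ ∅ (Finset.mem_erase.2 ⟨fun e => hne (by simp [e]), h⟩)
    simp at hx
  have := Finset.card_le_card h1
  rw [Finset.card_singleton] at this
  unfold deficiency at hδ
  omega

theorem IsTwoMU.exists_arc (hF : IsTwoMU F) (h0 : ∅ ∉ F) {C : Finset (Lit V)} (hC : C ∈ F) :
    ∃ a b : {x : Lit V // x ∈ lits F}, C = {compl a.1, b.1} ∧ (idg F).Adj a b := by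
  obtain ⟨x, hx⟩ := Finset.nonempty_iff_ne_empty.2 fun e => h0 (e ▸ hC)
  obtain ⟨y, rfl⟩ := hF.exists_pair hC hx
  refine ⟨⟨compl x, compl_mem_lits (mem_lits_of_mem hC hx)⟩,
    ⟨y, mem_lits_of_mem hC (by simp)⟩, by rw [compl_compl], ?_⟩
  rw [idg_adj, compl_compl]
  exact hC

theorem exists_contradiction (hF : IsTwoMU F) (h0 : ∅ ∉ F) :
    ∃ x, ReflTransGen (idg F).Adj x (litCompl F x) ∧
      ReflTransGen (idg F).Adj (litCompl F x) x := by
  classical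
  by_contra h
  obtain ⟨S, hS, hS'⟩ := exists_consistent_closed (A := (idg F).Adj) (σ := litCompl F)
    litCompl_litCompl (fun _ _ => idg_skew) fun x h1 h2 => h ⟨x, h1, h2⟩
  let τ : V → Bool := fun v => decide (∃ h : (v, true) ∈ lits F, ⟨(v, true), h⟩ ∈ S)
  have hτ : ∀ x : {x : Lit V // x ∈ lits F}, x ∈ S → τ x.1.1 = x.1.2 := by
    rintro ⟨⟨v, b⟩, hx⟩ hxS
    cases b
    · simp only [τ, decide_eq_false_iff_not, not_exists]
      intro h1 h2
      exact (hS' _).1 h2 hxS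
    · simp only [τ, decide_eq_true_eq]
      exact ⟨hx, hxS⟩
  clear_value τ
  refine hF.2.1.1 ⟨τ, fun C hC => ?_⟩
  obtain ⟨a, b, rfl, hab⟩ := hF.exists_arc h0 hC
  by_cases ha : a ∈ S
  · exact ⟨b, by simp, hτ b (hS _ _ hab ha)⟩
  · refine ⟨compl a.1, by simp, hτ (litCompl F a) ?_⟩
    rw [hS', litCompl_litCompl]
    exact ha

/-- If `B` omits an arc, skew-closure keeps all arcs of the corresponding clause out of `B`. An
assignment satisfying the other clauses propagates truth along `B`, which contradicts the walks
between `x` and its complement. -/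
theorem IsTwoMU.arcs_minimal (hF : IsTwoMU F)
    (B : {x : Lit V // x ∈ lits F} → {x : Lit V // x ∈ lits F} → Prop)
    (hB : ∀ x y, B x y → (idg F).Adj x y)
    (hBs : ∀ x y, B x y → B (litCompl F y) (litCompl F x)) (x : {x : Lit V // x ∈ lits F})
    (h1 : ReflTransGen B x (litCompl F x)) (h2 : ReflTransGen B (litCompl F x) x)
    (a b : {x : Lit V // x ∈ lits F}) (hab : (idg F).Adj a b) : B a b := by
  by_contra hnab
  obtain ⟨τ, hτ⟩ := hF.2.1.2 _ (idg_adj.1 hab)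
  have hcompl : ∀ u : Lit V, τ u.1 = u.2 → τ (compl u).1 ≠ (compl u).2 := by
    intro u hu
    simp [compl, hu]
  have hstep : ∀ u v, B u v → τ u.1.1 = u.1.2 → τ v.1.1 = v.1.2 := by
    intro u v huv hu
    have hne : ({compl u.1, v.1} : Finset (Lit V)) ≠ {compl a.1, b.1} := by
      intro e
      rcases pair_eq_pair e with ⟨e1, e2⟩ | ⟨e1, e2⟩
      · have h1 : u = a := Subtype.ext (by rw [← compl_compl u.1, e1, compl_compl])
        have h2 : v = b := Subtype.ext e2
        exact hnab (h1 ▸ h2 ▸ huv)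
      · have h1 : litCompl F u = b := Subtype.ext e1
        have h2 : litCompl F v = a := Subtype.ext ((congrArg compl e2).trans (compl_compl _))
        exact hnab (h1 ▸ h2 ▸ hBs _ _ huv)
    obtain ⟨l, hl, hlτ⟩ := hτ {compl u.1, v.1} (Finset.mem_erase.2 ⟨hne, hB u v huv⟩)
    rcases Finset.mem_insert.1 hl with rfl | hl
    · exact absurd hlτ (hcompl _ hu)
    · rw [Finset.mem_singleton.1 hl] at hlτ
      exact hlτ
  have hreach : ∀ u v, ReflTransGen B u v → τ u.1.1 = u.1.2 → τ v.1.1 = v.1.2 := by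
    intro u v huv hu
    induction huv with
    | refl => exact hu
    | tail _ hbc ih => exact hstep _ _ hbc ih
  by_cases hx : τ x.1.1 = x.1.2
  · exact hcompl _ hx (hreach _ _ h1 hx)
  · refine hx (hreach _ _ h2 ?_)
    change τ x.1.1 = !x.1.2
    revert hx
    cases τ x.1.1 <;> cases x.1.2 <;> simp

theorem IsTwoMU.isSkewMinimal (hF : IsTwoMU F) (h0 : ∅ ∉ F) :
    IsSkewMinimal (idg F).Adj (litCompl F) := by
  obtain ⟨x, h1, h2⟩ := exists_contradiction hF h0
  have hs : ∀ {a b}, ReflTransGen (idg F).Adj a b →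
      ReflTransGen (idg F).Adj (litCompl F b) (litCompl F a) :=
    reflTransGen_skew fun _ _ => idg_skew
  refine ⟨litCompl_litCompl, fun x e => compl_ne _ (congrArg Subtype.val e), idg_skew, ?_,
    hF.arcs_minimal⟩
  -- The arcs on closed walks through `x`. They are skew-closed and contain the contradiction, hence
  -- are all arcs, and every literal lies on an arc.
  let B : {x : Lit V // x ∈ lits F} → {x : Lit V // x ∈ lits F} → Prop := fun a b =>
    (idg F).Adj a b ∧ ReflTransGen (idg F).Adj x a ∧ ReflTransGen (idg F).Adj b x
  have hB : ∀ a b, ReflTransGen (idg F).Adj a b → ReflTransGen (idg F).Adj x a →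
      ReflTransGen (idg F).Adj b x → ReflTransGen B a b := by
    intro a b hab
    induction hab with
    | refl => exact fun _ _ => .refl
    | @tail c d hac hcd ih =>
      intro ha hb
      exact (ih ha (ReflTransGen.head hcd hb)).tail ⟨hcd, ha.trans hac, hb⟩
  have key := hF.arcs_minimal B (fun _ _ h => h.1)
    (fun a b h => ⟨idg_skew h.1, h1.trans (hs h.2.2), (hs h.2.1).trans h2⟩) x
    (hB _ _ h1 .refl h2) (hB _ _ h2 h1 .refl)
  have hx : ∀ z, ReflTransGen (idg F).Adj x z ∧ ReflTransGen (idg F).Adj z x := by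
    intro z
    obtain ⟨C, hC, y, hy, hyz⟩ := mem_lits.1 z.2
    obtain ⟨w, rfl⟩ := hF.exists_pair hC hy
    have hyF := mem_lits_of_mem hC hy
    have hwF := mem_lits_of_mem hC (x := w) (by simp)
    have e1 : (idg F).Adj (litCompl F ⟨y, hyF⟩) ⟨w, hwF⟩ := by
      rw [idg_adj]; simpa only [litCompl, compl_compl] using hC
    have e2 : (idg F).Adj (litCompl F ⟨w, hwF⟩) ⟨y, hyF⟩ := by
      rw [idg_adj]; simpa only [litCompl, compl_compl, Finset.pair_comm] using hC
    have k1 := key _ _ e1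
    have k2 := key _ _ e2
    have hz : z = ⟨y, hyF⟩ ∨ z = litCompl F ⟨y, hyF⟩ := by
      rcases Bool.eq_or_eq_not z.1.2 y.2 with h | h
      · exact .inl (Subtype.ext (Prod.ext hyz.symm h))
      · exact .inr (Subtype.ext (Prod.ext hyz.symm h))
    rcases hz with rfl | rfl
    · exact ⟨k2.2.1.tail k2.1, k2.2.2⟩
    · exact ⟨k1.2.1, ReflTransGen.head k1.1 k1.2.2⟩
  exact fun a b => (hx a).2.trans (hx b).1

/-- A unit clause is a walk of length one from `x` to its complement. A lasso through `s` variables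
supplies all other clauses, so there are at most `s + 1` clauses, and the deficiency is at most one.
-/
theorem IsTwoMU.noUnit (hF : IsTwoMU F) {k : ℕ} (hk : 2 ≤ k) (hδ : deficiency F = (k : ℤ)) :
    NoUnit (idg F).Adj (litCompl F) := by
  intro x hx
  have h0 := hF.empty_notMem hk hδ
  have H := hF.isSkewMinimal h0
  obtain ⟨s, j, q, hjs, hq0, hq, hqv, hqs, hc⟩ :=
    H.lasso (p := fun t => if t = 0 then x else litCompl F x) (r := 1)
      (by intro i hi; obtain rfl : i = 0 := by omega
          simpa) (by simp)
  have h1 := (hqv.two_mul_le H.ne fun _ _ => H.inj).1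
  rw [card_lits] at h1
  have h2 : F ⊆ insert {compl x.1}
      ((Finset.range s).image fun i => {compl (q i).1, (q (i + 1)).1}) := by
    intro C hC
    obtain ⟨a, b, rfl, hab⟩ := hF.exists_arc h0 hC
    rw [Finset.mem_insert, Finset.mem_image]
    rcases hc a b hab with ⟨i, hi, h⟩ | ⟨i, hi, h⟩
    · obtain rfl : i = 0 := by omega
      left
      rcases h with ⟨rfl, rfl⟩ | ⟨rfl, rfl⟩ <;> simp [litCompl, compl_compl]
    · refine .inr ⟨i, Finset.mem_range.2 hi, ?_⟩
      rcases h with ⟨rfl, rfl⟩ | ⟨rfl, rfl⟩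
      · rfl
      · simp only [litCompl, compl_compl]
        exact Finset.pair_comm _ _
  have h3 := Finset.card_le_card h2
  have h4 := Finset.card_insert_le ({compl x.1} : Finset (Lit V))
    ((Finset.range s).image fun i => {compl (q i).1, (q (i + 1)).1})
  have h5 := Finset.card_image_le (s := Finset.range s)
    (f := fun i => ({compl (q i).1, (q (i + 1)).1} : Finset (Lit V)))
  rw [Finset.card_range] at h5
  unfold deficiency at hδ
  omega

theorem IsTwoMU.card_arcs (hF : IsTwoMU F) (h0 : ∅ ∉ F)
    (hnu : NoUnit (idg F).Adj (litCompl F)) :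
    Nat.card {e : {x : Lit V // x ∈ lits F} × {x : Lit V // x ∈ lits F} //
      (idg F).Adj e.1 e.2} = 2 * F.card := by
  classical
  rw [Nat.card_eq_fintype_card, Fintype.card_subtype,
    Finset.card_eq_sum_card_fiberwise (f := fun e => ({compl e.1.1, e.2.1} : Finset (Lit V)))
      (t := F) (by intro e he; exact idg_adj.1 (Finset.mem_filter.1 he).2)]
  rw [Finset.sum_const_nat (m := 2), mul_comm]
  intro C hC
  obtain ⟨a, b, rfl, hab⟩ := hF.exists_arc h0 hC
  have hne : ((a, b) : _ × _) ≠ (litCompl F b, litCompl F a) := by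
    intro e
    have h1 := congrArg Prod.snd e
    simp only at h1
    rw [h1] at hab
    exact hnu a hab
  rw [← Finset.card_pair hne]
  congr 1
  ext ⟨u, v⟩
  simp only [Finset.mem_filter, Finset.mem_univ, true_and, Finset.mem_insert,
    Finset.mem_singleton, Prod.mk.injEq]
  constructor
  · rintro ⟨-, e⟩
    rcases pair_eq_pair e with ⟨e1, e2⟩ | ⟨e1, e2⟩
    · exact .inl ⟨Subtype.ext (by rw [← compl_compl u.1, e1, compl_compl]), Subtype.ext e2⟩
    · exact .inr ⟨Subtype.ext (by rw [← compl_compl u.1, e1]; rfl), Subtype.ext e2⟩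
  · rintro (⟨rfl, rfl⟩ | ⟨rfl, rfl⟩)
    · exact ⟨hab, rfl⟩
    · refine ⟨idg_skew hab, ?_⟩
      simp only [litCompl, compl_compl]
      exact Finset.pair_comm _ _

/-- Twice the number of clauses counts the arcs, and twice the number of variables the vertices;
their difference is the number of vertices of in-degree two. -/
theorem IsTwoMU.card_twoIn (hF : IsTwoMU F) {k : ℕ} (hk : 2 ≤ k)
    (hδ : deficiency F = (k : ℤ)) :
    Nat.card {z // TwoIn (idg F).Adj z} = 2 * k := by
  have h0 := hF.empty_notMem hk hδ
  have h1 := (hF.isSkewMinimal h0).card_arcs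
  rw [hF.card_arcs h0 (hF.noUnit hk hδ), card_lits] at h1
  unfold deficiency at hδ
  omega

theorem ClauseSetIso.digraphIso {F F' : ClauseSet V} (h : ClauseSetIso F F') :
    DigraphIso (idg F) (idg F') := by
  obtain ⟨f, hf, hc, himg⟩ := h
  refine ⟨hf.equiv f, fun a b => ?_⟩
  rw [idg_adj, idg_adj]
  have e : ({compl (hf.equiv f a).1, (hf.equiv f b).1} : Finset (Lit V)) =
      ({compl a.1, b.1} : Finset (Lit V)).image f := by
    rw [Finset.image_insert, Finset.image_singleton, hc _ a.2]
    rfl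
  rw [e, ← himg, Finset.mem_image]
  constructor
  · exact fun h => ⟨_, h, rfl⟩
  · rintro ⟨C, hC, hCe⟩
    -- `f` is injective only on `lits F`, so clauses are recovered from their images inside that
    -- set.
    have h1 : ∀ D : Finset (Lit V), D ⊆ lits F → ∀ x ∈ lits F, x ∈ D ↔ f x ∈ D.image f := by
      intro D hD x hx
      rw [Finset.mem_image]
      refine ⟨fun h => ⟨x, h, rfl⟩, ?_⟩
      rintro ⟨y, hy, hyx⟩
      rwa [← hf.injOn (hD hy) hx hyx]
    have hCl : C ⊆ lits F := fun x hx => mem_lits_of_mem hC hx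
    have hDl : ({compl a.1, b.1} : Finset (Lit V)) ⊆ lits F := by
      intro x hx
      rcases Finset.mem_insert.1 hx with rfl | hx
      · exact compl_mem_lits a.2
      · rw [Finset.mem_singleton.1 hx]; exact b.2
    have : C = {compl a.1, b.1} := by
      ext x
      by_cases hx : x ∈ lits F
      · rw [h1 _ hCl x hx, h1 _ hDl x hx, hCe]
      · exact ⟨fun h => absurd (hCl h) hx, fun h => absurd (hDl h) hx⟩
    rwa [← this]

theorem clauseSetIso_of_equiv {F F' : ClauseSet V} (hF : IsTwoMU F) (h0 : ∅ ∉ F)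
    (hF' : IsTwoMU F') (h0' : ∅ ∉ F')
    (φ : {x : Lit V // x ∈ lits F} ≃ {x : Lit V // x ∈ lits F'})
    (hφ : ∀ a b, (idg F).Adj a b ↔ (idg F').Adj (φ a) (φ b))
    (hc : ∀ a, φ (litCompl F a) = litCompl F' (φ a)) : ClauseSetIso F F' := by
  let f : Lit V → Lit V := fun x => if h : x ∈ lits F then (φ ⟨x, h⟩).1 else x
  have hf : ∀ a : {x : Lit V // x ∈ lits F}, f a.1 = (φ a).1 := fun a => by simp [f, a.2]
  have hfc : ∀ a : {x : Lit V // x ∈ lits F}, f (compl a.1) = compl (φ a).1 := fun a => by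
    change f (litCompl F a).1 = _
    rw [hf, hc]; rfl
  refine ⟨f, ⟨fun x hx => ?_, fun x hx y hy e => ?_, fun y hy => ?_⟩, fun x hx => ?_, ?_⟩
  · have := (φ ⟨x, hx⟩).2
    rw [← hf] at this
    exact this
  · have e' : f (⟨x, hx⟩ : {x : Lit V // x ∈ lits F}).1 =
      f (⟨y, hy⟩ : {x : Lit V // x ∈ lits F}).1 := e
    rw [hf, hf] at e'
    exact congrArg Subtype.val (φ.injective (Subtype.ext e'))
  · exact ⟨(φ.symm ⟨y, hy⟩).1, (φ.symm ⟨y, hy⟩).2, by rw [hf, φ.apply_symm_apply]⟩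
  · have h1 := hfc ⟨x, hx⟩
    have h2 := hf ⟨x, hx⟩
    rw [h1, h2]
  · have himg : ∀ a b : {x : Lit V // x ∈ lits F},
        ({compl a.1, b.1} : Finset (Lit V)).image f = {compl (φ a).1, (φ b).1} := by
      intro a b
      rw [Finset.image_insert, Finset.image_singleton, hfc, hf]
    ext D
    rw [Finset.mem_image]
    constructor
    · rintro ⟨C, hC, rfl⟩
      obtain ⟨a, b, rfl, hab⟩ := hF.exists_arc h0 hC
      rw [himg]
      exact (hφ a b).1 hab
    · intro hD
      obtain ⟨a, b, rfl, hab⟩ := hF'.exists_arc h0' hD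
      refine ⟨{compl (φ.symm a).1, (φ.symm b).1}, (hφ _ _).2 (by simpa using hab), ?_⟩
      rw [himg, φ.apply_symm_apply, φ.apply_symm_apply]

end ClauseSets

end TwoMU

theorem mainTheorem5 {V : Type u} [DecidableEq V] (k : ℕ) (hk : 2 ≤ k)
    (F F' : TwoMU.ClauseSet V)
    (hF : TwoMU.IsTwoMU F) (hδ : TwoMU.deficiency F = (k : ℤ))
    (hF' : TwoMU.IsTwoMU F') (hδ' : TwoMU.deficiency F' = (k : ℤ)) :
    (TwoMU.ClauseSetIso F F' ↔ TwoMU.DigraphIso (TwoMU.idg F) (TwoMU.idg F')) ∧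
      TwoMU.IsWDC (2 * k) (TwoMU.idg F) ∧ TwoMU.IsWDC (2 * k) (TwoMU.idg F') := by
  have h0 := hF.empty_notMem hk hδ
  have h0' := hF'.empty_notMem hk hδ'
  have H := hF.isSkewMinimal h0
  have H' := hF'.isSkewMinimal h0'
  obtain ⟨hW, h, hh, hσ⟩ :=
    H.isWDC_and_exists_labeling hk (hF.noUnit hk hδ) (hF.card_twoIn hk hδ)
  obtain ⟨hW', h', hh', hσ'⟩ :=
    H'.isWDC_and_exists_labeling hk (hF'.noUnit hk hδ') (hF'.card_twoIn hk hδ')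
  refine ⟨⟨fun e => e.digraphIso, ?_⟩, hW, hW'⟩
  rintro ⟨φ, hφ⟩
  refine TwoMU.clauseSetIso_of_equiv hF h0 hF' h0' φ hφ fun a => ?_
  -- The complementation of `F'`, pulled back along `φ`, is a second skew-symmetry of `idg F`, with
  -- the labelling `h' ∘ φ`.
  have := H.compl_unique hk (σ' := fun z => φ.symm (TwoMU.litCompl F' (φ z)))
    (fun x => by simp [H'.invol]) (fun {x y} hxy => (hφ _ _).2 (by
      simpa using H'.skew ((hφ _ _).1 hxy))) hh (hh'.comp_equiv φ hφ) hσ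
    (fun z hz => by simpa using hσ' _ ((TwoMU.twoIn_congr φ hφ).1 hz)) a
  rw [this, φ.apply_symm_apply]
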